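/- **Setting.** Let $m\ge 2$ be the number of candidates and $\Delta^m=\{x\in\mathbb R_{\ge 0}^m:\sum_j x_j=1\}$. An instance with $n\ge 1$ agents is $\mathcal I=(s_1,\dots,s_n)\in(\Delta^m)^n$; an aggregation rule $F$ maps every instance (for every $n\ge1$) to a vector $F(\mathcal I)\in\Delta^m$. The disutility of agent $i$ for $x\in\Delta^m$ is $d_i(x)=\sum_{j}|s_{i,j}-x_j|$. **Rules.** For $f$ the average, maximum, minimum, median (average of the two middle values if $n$ is even) or geometric mean, the rules Avg, Max, Min, Med, Geo give $F(\mathcal I)_j=f(s_{1,j},\dots,s_{n,j})/\sum_k f(s_{1,k},\dots,s_{n,k})$, and $F(\mathcal I)_j=1/m$ for all $j$ if this denominator is $0$. Util returns the maximizer of $-\sum_i d_i(x)$ over $\Delta^m$ that minimizes $\sum_j(x_j-\frac1m)^2$. An *Egal outcome* of $\mathcal I$ is an $x\in\Delta^m$ whose vector of disutilities $(d_i(x))_i$, sorted in non-increasing order, is lexicographically minimal; an *Egal rule* is any rule that always returns an Egal outcome. The tie-breaking of an Egal rule $F$ is *consistent* on a class of instances if, whenever $x\ne y$ are both Egal outcomes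 of two instances $\mathcal I,\mathcal I'$ of the class and $F(\mathcal I)=x$, then $F(\mathcal I')\ne y$. IM returns $x_j=\mathrm{med}(s_{1,j},\dots,s_{n,j},f_0(t^*),\dots,f_n(t^*))$ with $f_k(t)=\min(kt,1)$, where $t^*\in[0,1]$ is the smallest $t$ at which these $m$ medians sum to $1$. **Axioms.** *Independence* (for given $m,n$): if $s_{i,j}=s'_{i,j}$ for all agents $i$, then $F(\mathcal I)_j=F(\mathcal I')_j$. *Score-monotonicity* (for given $m,n$): $F(\mathcal I)_j\le F(\mathcal I')_j$ whenever there is an agent $i$ with $s_\ell=s'_\ell$ for all $\ell\ne i$, $s_{i,j}<s'_{i,j}$, and $s_{i,k}\ge s'_{i,k}$ for all $k\ne j$. *Reinforcement* (for given $m$): for all instances $\mathcal I=(s_1,\dots,s_n)$ and $\mathcal I'=(s'_1,\dots,s'_{n'})$ with $F(\mathcal I)=F(\mathcal I')$ one has $F(s_1,\dots,s_n,s'_1,\dots,s'_{n'})=F(\mathcal I)$. **Theorem.** 1. Avg satisfies independence for all $m\ge2$, $n\ge1$. Med satisfies independence when $m=2$ or $n=2$, but fails it for all $m\ge3$ and $n\ge3$.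 Every Egal rule satisfies independence when $m=2$, and also when $n=2$ provided that it coincides with Avg on all two-agent instances; every Egal rule fails independence for all $m\ge 3$ and $n\ge3$. Max, Min, Geo, Util and IM satisfy independence when $m=2$, but fail it for all $m\ge3$ and $n\ge2$. 2. Avg, Max, Min, Med, Geo, Util and IM satisfy score-monotonicity for all $m\ge2$, $n\ge1$. Every Egal rule satisfies score-monotonicity when $m=2$, and also when $n=2$ provided that it coincides with Avg on all two-agent instances; every Egal rule fails score-monotonicity for all $m\ge4$ and $n\ge4$. 3. Avg, Min, Max, Geo, Util and IM satisfy reinforcement for all $m\ge2$. Every Egal rule whose tie-breaking is consistent on all instances satisfies reinforcement. Every Egal rule whose tie-breaking is consistent on all instances with $n\neq2$ agents (for instance one that coincides with Avg on two-agent instances) satisfies the reinforcement condition for all pairs of instances except possibly pairs with $n=n'=2$. Med satisfies reinforcement when $m=2$, but for every $m\ge3$ it fails reinforcement, even when restricted to pairs of instances with at least two agents each. -/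

import Mathlib

noncomputable section

namespace Portioning

/-- The set `Δ^m` of probability distributions over `m` candidates. -/
abbrev Dist (m : ℕ) : Type := stdSimplex ℝ (Fin m)

/-- An instance with `n` agents and `m` candidates: `I i j` is the score of agent `i` for
candidate `j`. -/
abbrev Profile (m n : ℕ) : Type := Fin n → Dist m

/-- An aggregation rule for `m` candidates, with a variable (non-empty) electorate. -/
abbrev AggregationRule (m : ℕ) : Type := ∀ (n : ℕ) [NeZero n], Profile m n → Dist m

/-! ### Order statistics and the median -/

/-- The entries of `v` in non-decreasing order. -/
def sorted {n : ℕ} (v : Fin n → ℝ) : Fin n → ℝ := v ∘ Tuple.sort v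

theorem sorted_le_iff {n : ℕ} (v : Fin n → ℝ) (k : Fin n) (a : ℝ) :
    sorted v k ≤ a ↔ (k : ℕ) < (Finset.univ.filter fun i => v i ≤ a).card := by
  have h := Tuple.lt_card_le_iff_apply_le_of_monotone (f := sorted v) (j := k) (a := a)
    (Tuple.monotone_sort v)
  have hc : Fintype.card {i // sorted v i ≤ a} = Fintype.card {i // v i ≤ a} :=
    Fintype.card_congr ((Tuple.sort v).subtypeEquiv fun i => Iff.rfl)
  rw [Fintype.card_subtype, Fintype.card_subtype] at hc
  rw [hc] at h
  exact h.symm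

/-- The median of the entries of `v`: the middle entry if `n` is odd (then the two indices below
agree), the average of the two middle entries if `n` is even. -/
def median {n : ℕ} [NeZero n] (v : Fin n → ℝ) : ℝ :=
  (sorted v ⟨(n - 1) / 2, by have := NeZero.pos n; omega⟩
    + sorted v ⟨n / 2, by have := NeZero.pos n; omega⟩) / 2

theorem median_nonneg {n : ℕ} [NeZero n] (v : Fin n → ℝ) (h : ∀ i, 0 ≤ v i) : 0 ≤ median v :=
  div_nonneg (add_nonneg (h _) (h _)) (by norm_num)

theorem sorted_le_add {n : ℕ} (v w : Fin n → ℝ) (c : ℝ) (h : ∀ i, v i ≤ w i + c) (k : Fin n) :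
    sorted v k ≤ sorted w k + c := by
  rw [sorted_le_iff]
  refine lt_of_lt_of_le ((sorted_le_iff w k _).1 le_rfl) (Finset.card_le_card ?_)
  intro i hi
  simp only [Finset.mem_filter, Finset.mem_univ, true_and] at hi ⊢
  linarith [h i]

theorem continuous_sorted {n : ℕ} (k : Fin n) : Continuous fun v : Fin n → ℝ => sorted v k := by
  refine (LipschitzWith.of_le_add_mul 1 fun v w => ?_).continuous
  refine sorted_le_add v w _ (fun i => ?_) k
  have h1 : v i - w i ≤ dist (v i) (w i) := by rw [Real.dist_eq]; exact le_abs_self _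
  have h2 := dist_le_pi_dist v w i
  simp only [NNReal.coe_one, one_mul]
  linarith

theorem continuous_median {n : ℕ} [NeZero n] : Continuous fun v : Fin n → ℝ => median v :=
  ((continuous_sorted _).add (continuous_sorted _)).div_const 2

/-! ### Coordinate-wise rules -/

/-- Divide a non-negative vector by its sum; the zero vector is sent to the uniform
distribution. -/
def normalize {m : ℕ} [NeZero m] (a : Fin m → ℝ) (ha : ∀ j, 0 ≤ a j) : Dist m :=
  ⟨fun j => if ∑ k, a k = 0 then 1 / (m : ℝ) else a j / ∑ k, a k, by
    have hm : (m : ℝ) ≠ 0 := Nat.cast_ne_zero.2 (NeZero.ne m)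
    have hs : 0 ≤ ∑ k, a k := Finset.sum_nonneg fun k _ => ha k
    constructor
    · intro j
      dsimp only
      split_ifs
      · positivity
      · exact div_nonneg (ha j) hs
    · split_ifs with h
      · simp [hm]
      · rw [← Finset.sum_div, div_self h]⟩

/-- The coordinate-wise rule with coordinate-aggregation functions `f n` (the same for all
candidates). -/
def coordRule {m : ℕ} [NeZero m] (f : ∀ (n : ℕ) [NeZero n], (Fin n → ℝ) → ℝ)
    (hf : ∀ (n : ℕ) [NeZero n] (v : Fin n → ℝ), (∀ i, 0 ≤ v i) → 0 ≤ f n v) :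
    AggregationRule m :=
  fun n _ I => normalize (fun j => f n fun i => I i j) fun j => hf n _ fun i => (I i).2.1 j

/-- The average rule. -/
def avgRule (m : ℕ) [NeZero m] : AggregationRule m :=
  coordRule (fun n _ v => (∑ i, v i) / n)
    fun _ _ _ h => div_nonneg (Finset.sum_nonneg fun i _ => h i) (Nat.cast_nonneg _)

/-- The maximum rule. -/
def maxRule (m : ℕ) [NeZero m] : AggregationRule m :=
  coordRule (fun _ _ v => Finset.univ.sup' Finset.univ_nonempty v)
    fun _ _ v h => (h 0).trans (Finset.le_sup' v (Finset.mem_univ 0))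

/-- The minimum rule. -/
def minRule (m : ℕ) [NeZero m] : AggregationRule m :=
  coordRule (fun _ _ v => Finset.univ.inf' Finset.univ_nonempty v)
    fun _ _ v h => Finset.le_inf' _ v fun i _ => h i

/-- The median rule. -/
def medRule (m : ℕ) [NeZero m] : AggregationRule m :=
  coordRule (fun _ _ v => median v) fun _ _ v h => median_nonneg v h

/-- The geometric mean rule. -/
def geoRule (m : ℕ) [NeZero m] : AggregationRule m :=
  coordRule (fun n _ v => (∏ i, v i) ^ (1 / (n : ℝ)))
    fun _ _ _ h => Real.rpow_nonneg (Finset.prod_nonneg fun i _ => h i) _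

/-! ### Welfare-based rules -/

/-- The `ℓ₁` disutility of an agent with score vector `s` for the outcome `x`. -/
def disutility {m : ℕ} (s x : Dist m) : ℝ := ∑ j, |s j - x j|

/-- The utilitarian welfare of `x`. -/
def utilWelfare {m n : ℕ} (I : Profile m n) (x : Dist m) : ℝ := -∑ i, disutility (I i) x

/-- The squared `ℓ₂` distance of `x` to the uniform distribution. -/
def distUniform {m : ℕ} (x : Dist m) : ℝ := ∑ j, (x j - 1 / (m : ℝ)) ^ 2

/-- `x` maximizes the utilitarian welfare and, among all maximizers, is closest to the uniform
distribution. -/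
def IsUtilOutcome {m n : ℕ} (I : Profile m n) (x : Dist m) : Prop :=
  (∀ y, utilWelfare I y ≤ utilWelfare I x) ∧
    ∀ y, (∀ z, utilWelfare I z ≤ utilWelfare I y) → distUniform x ≤ distUniform y

theorem continuous_coord {m : ℕ} (j : Fin m) : Continuous fun x : Dist m => x j :=
  (continuous_apply j).comp continuous_subtype_val

theorem continuous_utilWelfare {m n : ℕ} (I : Profile m n) : Continuous (utilWelfare I) :=
  (continuous_finsetSum _ fun _ _ => continuous_finsetSum _ fun j _ =>
    (continuous_const.sub (continuous_coord j)).abs).neg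

theorem continuous_distUniform {m : ℕ} : Continuous (distUniform (m := m)) :=
  continuous_finsetSum _ fun j _ => ((continuous_coord j).sub continuous_const).pow 2

theorem exists_isUtilOutcome {m n : ℕ} [NeZero m] (I : Profile m n) :
    ∃ x, IsUtilOutcome I x := by
  obtain ⟨x₀, -, h₀⟩ := isCompact_univ.exists_isMaxOn Set.univ_nonempty
    (continuous_utilWelfare I).continuousOn
  have hK : IsCompact {x : Dist m | utilWelfare I x₀ ≤ utilWelfare I x} :=
    (isClosed_le continuous_const (continuous_utilWelfare I)).isCompact
  obtain ⟨x, hx, hmin⟩ := hK.exists_isMinOn ⟨x₀, le_refl (utilWelfare I x₀)⟩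
    continuous_distUniform.continuousOn
  refine ⟨x, fun y => (h₀ (Set.mem_univ y)).trans hx, fun y hy => hmin (hy x₀)⟩

/-- The outcome of an instance is unique, so the choice in the definition of `utilRule` is immaterial. -/
theorem isUtilOutcome_unique {m n : ℕ} (I : Profile m n) (x y : Dist m)
    (hx : IsUtilOutcome I x) (hy : IsUtilOutcome I y) : x = y := by
  let z : Dist m := ⟨fun j => (x j + y j) / 2, by
    refine ⟨fun j => ?_, ?_⟩
    · have h1 := x.2.1 j
      have h2 := y.2.1 j
      exact div_nonneg (add_nonneg h1 h2) (by norm_num)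
    · have h1 : ∑ j, x j = 1 := x.2.2
      have h2 : ∑ j, y j = 1 := y.2.2
      rw [← Finset.sum_div, Finset.sum_add_distrib, h1, h2]
      norm_num⟩
  have hzj : ∀ j, z j = (x j + y j) / 2 := fun _ => rfl
  have hw : (utilWelfare I x + utilWelfare I y) / 2 ≤ utilWelfare I z := by
    have : ∑ i, disutility (I i) z ≤
        ∑ i, (disutility (I i) x + disutility (I i) y) / 2 := by
      refine Finset.sum_le_sum fun i _ => ?_
      unfold disutility
      rw [← Finset.sum_add_distrib, Finset.sum_div]
      refine Finset.sum_le_sum fun j _ => ?_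
      rw [hzj]
      have : I i j - (x j + y j) / 2 = ((I i j - x j) + (I i j - y j)) / 2 := by ring
      rw [this, abs_div, abs_two]
      have := abs_add_le (I i j - x j) (I i j - y j)
      linarith
    rw [← Finset.sum_div, Finset.sum_add_distrib] at this
    unfold utilWelfare
    linarith
  have hz : ∀ u, utilWelfare I u ≤ utilWelfare I z := fun u => by
    linarith [hx.1 u, hy.1 u]
  have e1 := hx.2 z hz
  have e2 := hy.2 z hz
  have key : distUniform z
      = (distUniform x + distUniform y) / 2 - (∑ j, (x j - y j) ^ 2) / 4 := by
    unfold distUniform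
    rw [← Finset.sum_add_distrib, Finset.sum_div, Finset.sum_div, ← Finset.sum_sub_distrib]
    refine Finset.sum_congr rfl fun j _ => ?_
    rw [hzj]
    ring
  have hs : ∑ j, (x j - y j) ^ 2 = 0 :=
    le_antisymm (by linarith) (Finset.sum_nonneg fun _ _ => sq_nonneg _)
  rw [Finset.sum_eq_zero_iff_of_nonneg fun _ _ => sq_nonneg _] at hs
  ext j
  have := hs j (Finset.mem_univ j)
  exact sub_eq_zero.1 (pow_eq_zero_iff (two_ne_zero) |>.1 this)

/-- The utilitarian rule with maximum-entropy tie-breaking. -/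
def utilRule (m : ℕ) [NeZero m] : AggregationRule m :=
  fun _ _ I => (exists_isUtilOutcome I).choose

theorem util_spec {m n : ℕ} [NeZero m] [NeZero n] (I : Profile m n) :
    IsUtilOutcome I (utilRule m n I) := (exists_isUtilOutcome I).choose_spec

/-- The disutilities of all agents from `x`, in non-increasing order. -/
def disutilityVector {m n : ℕ} (I : Profile m n) (x : Dist m) : Fin n → ℝ :=
  fun k => sorted (fun i => disutility (I i) x) k.rev

/-- `x` is an egalitarian outcome: it minimizes the sorted disutility vector lexicographically
(so in particular it minimizes the largest disutility). The order on `Lex (Fin n → ℝ)` is the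
lexicographic one. -/
def IsEgalOutcome {m n : ℕ} (I : Profile m n) (x : Dist m) : Prop :=
  ∀ y, toLex (disutilityVector I x) ≤ toLex (disutilityVector I y)

/-- `F` is an egalitarian rule: it always returns an egalitarian outcome. Ties between
egalitarian outcomes may be broken in any way. -/
def IsEgalRule {m : ℕ} (F : AggregationRule m) : Prop :=
  ∀ (n : ℕ) [NeZero n] (I : Profile m n), IsEgalOutcome I (F n I)

/-- `F` coincides with the average rule on instances with two agents. -/
def AgreesWithAvgOnPairs {m : ℕ} [NeZero m] (F : AggregationRule m) : Prop :=
  ∀ I : Profile m 2, F 2 I = avgRule m 2 I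

/-- Consistent tie-breaking among the instances whose number of agents lies in `S`: if `x` and `y`
are distinct egalitarian outcomes of both `I` and `I'`, and `F` chooses `x` for `I`, then it does
not choose `y` for `I'`. -/
def ConsistentTieBreaking {m : ℕ} (F : AggregationRule m) (S : Set ℕ) : Prop :=
  ∀ (n n' : ℕ) [NeZero n] [NeZero n'], n ∈ S → n' ∈ S →
    ∀ (I : Profile m n) (I' : Profile m n') (x y : Dist m),
      IsEgalOutcome I x → IsEgalOutcome I y → IsEgalOutcome I' x → IsEgalOutcome I' y →
        x ≠ y → F n I = x → F n' I' ≠ y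

/-! ### The independent markets rule -/

/-- The phantom functions of the independent markets rule. -/
def phantom (k : ℕ) (t : ℝ) : ℝ := min (k * t) 1

/-- The median of the `n` scores of candidate `j` and the `n + 1` phantom values at time `t`. -/
def imScore {m n : ℕ} (I : Profile m n) (t : ℝ) (j : Fin m) : ℝ :=
  median (Fin.append (fun i : Fin n => I i j) fun k : Fin (n + 1) => phantom k t)

/-- The times at which the medians sum up to one. -/
def imTimes {m n : ℕ} (I : Profile m n) : Set ℝ :=
  {t | t ∈ Set.Icc (0 : ℝ) 1 ∧ ∑ j, imScore I t j = 1}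

/-- The smallest time at which the medians sum up to one. -/
def imTime {m n : ℕ} (I : Profile m n) : ℝ := sInf (imTimes I)

theorem continuous_imScore {m n : ℕ} (I : Profile m n) (j : Fin m) :
    Continuous fun t => imScore I t j := by
  refine continuous_median.comp (continuous_pi fun l => ?_)
  refine Fin.addCases (fun i => ?_) (fun k => ?_) l
  · simp only [Fin.append_left]
    exact continuous_const
  · simp only [Fin.append_right]
    exact (continuous_const.mul continuous_id).min continuous_const

theorem imScore_nonneg {m n : ℕ} (I : Profile m n) {t : ℝ} (ht : 0 ≤ t) (j : Fin m) :
    0 ≤ imScore I t j := by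
  refine median_nonneg _ fun l => ?_
  refine Fin.addCases (fun i => ?_) (fun k => ?_) l
  · rw [Fin.append_left]
    exact (I i).2.1 j
  · rw [Fin.append_right]
    exact le_min (mul_nonneg (Nat.cast_nonneg _) ht) zero_le_one

theorem imScore_eq_sorted {m n : ℕ} (I : Profile m n) (t : ℝ) (j : Fin m) :
    imScore I t j = sorted (Fin.append (fun i : Fin n => I i j)
      fun k : Fin (n + 1) => phantom k t) ⟨n, by omega⟩ := by
  unfold imScore median
  have h1 : (n + (n + 1) - 1) / 2 = n := by omega
  have h2 : (n + (n + 1)) / 2 = n := by omega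
  simp only [h1, h2]
  ring

theorem isLeast_imTime {m n : ℕ} [NeZero n] (I : Profile m n) :
    IsLeast (imTimes I) (imTime I) := by
  have hcont : Continuous fun t => ∑ j, imScore I t j :=
    continuous_finsetSum _ fun j _ => continuous_imScore I j
  have h0 : ∑ j, imScore I 0 j ≤ 1 := by
    refine (Finset.sum_nonpos fun j _ => ?_).trans zero_le_one
    rw [imScore_eq_sorted, sorted_le_iff]
    have hsub : (Finset.univ.map (Fin.natAddEmb n : Fin (n + 1) ↪ Fin (n + (n + 1)))) ⊆
        Finset.univ.filter fun l => Fin.append (fun i : Fin n => I i j)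
          (fun k : Fin (n + 1) => phantom k 0) l ≤ 0 := by
      intro l hl
      obtain ⟨k, -, rfl⟩ := Finset.mem_map.1 hl
      simp [phantom]
    have := Finset.card_le_card hsub
    rw [Finset.card_map, Finset.card_univ, Fintype.card_fin] at this
    exact this
  have h1 : 1 ≤ ∑ j, imScore I 1 j := by
    have hs : ∑ j, I 0 j = 1 := (I 0).2.2
    refine hs.ge.trans (Finset.sum_le_sum fun j _ => ?_)
    rw [imScore_eq_sorted]
    by_contra! hlt
    obtain ⟨a, ha⟩ : ∃ a, a = sorted (Fin.append (fun i : Fin n => I i j)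
      fun k : Fin (n + 1) => phantom k 1) ⟨n, by omega⟩ := ⟨_, rfl⟩
    rw [← ha] at hlt
    have hcard := (sorted_le_iff _ _ _).1 ha.ge
    have hI : I 0 j ≤ 1 := by
      rw [← hs]
      exact Finset.single_le_sum (f := fun k => I 0 k) (fun k _ => (I 0).2.1 k)
        (Finset.mem_univ j)
    have hsub : (Finset.univ.filter fun l => Fin.append (fun i : Fin n => I i j)
        (fun k : Fin (n + 1) => phantom k 1) l ≤ a) ⊆
        ((Finset.univ.erase (0 : Fin n)).map (Fin.castAddEmb (n + 1))) ∪
          {Fin.natAdd n (0 : Fin (n + 1))} := by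
      intro l
      refine Fin.addCases (fun i => ?_) (fun k => ?_) l
      · intro hl
        simp only [Finset.mem_filter, Finset.mem_univ, true_and, Fin.append_left] at hl
        refine Finset.mem_union_left _ (Finset.mem_map.2 ⟨i, ?_, rfl⟩)
        refine Finset.mem_erase.2 ⟨?_, Finset.mem_univ _⟩
        rintro rfl
        linarith
      · intro hl
        simp only [Finset.mem_filter, Finset.mem_univ, true_and, Fin.append_right] at hl
        refine Finset.mem_union_right _ (Finset.mem_singleton.2 ?_)
        by_cases hk : (k : ℕ) = 0
        · congr 1
          exact Fin.ext hk
        · exfalso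
          have hk1 : (1 : ℝ) ≤ (k : ℕ) := by exact_mod_cast Nat.one_le_iff_ne_zero.2 hk
          have : phantom k 1 = 1 := by
            unfold phantom
            rw [mul_one]
            exact min_eq_right hk1
          linarith
    have h2 := (Finset.card_le_card hsub).trans (Finset.card_union_le _ _)
    rw [Finset.card_map, Finset.card_erase_of_mem (Finset.mem_univ _), Finset.card_univ,
      Fintype.card_fin, Finset.card_singleton] at h2
    have hn := NeZero.pos n
    simp only at hcard
    omega
  have hne : (imTimes I).Nonempty := by
    obtain ⟨t, ht, hte⟩ := intermediate_value_Icc (zero_le_one (α := ℝ)) hcont.continuousOn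
      ⟨h0, h1⟩
    exact ⟨t, ht, hte⟩
  have hcl : IsClosed (imTimes I) :=
    isClosed_Icc.inter (isClosed_eq hcont continuous_const)
  have hbd : BddBelow (imTimes I) := ⟨0, fun t ht => ht.1.1⟩
  exact ⟨hcl.csInf_mem hne hbd, fun t ht => csInf_le hbd ht⟩

/-- The independent markets rule. -/
def imRule (m : ℕ) : AggregationRule m :=
  fun _ _ I => ⟨imScore I (imTime I),
    fun j => imScore_nonneg I (isLeast_imTime I).1.1.1 j, (isLeast_imTime I).1.2⟩

/-! ### Axioms -/

/-- Independence, for instances with `n` agents. -/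
def Independence {m : ℕ} (F : AggregationRule m) (n : ℕ) [NeZero n] : Prop :=
  ∀ (I I' : Profile m n) (j : Fin m), (∀ i, I i j = I' i j) → F n I j = F n I' j

/-- Score-monotonicity, for instances with `n` agents. -/
def ScoreMonotone {m : ℕ} (F : AggregationRule m) (n : ℕ) [NeZero n] : Prop :=
  ∀ (I I' : Profile m n) (j : Fin m),
    (∃ i, (∀ l, l ≠ i → I l = I' l) ∧ I i j < I' i j ∧ ∀ k, k ≠ j → I' i k ≤ I i k) →
      F n I j ≤ F n I' j

/-- Reinforcement, for pairs of electorates of sizes `n` and `n'`. -/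
def ReinforcementFor {m : ℕ} (F : AggregationRule m) (n n' : ℕ) [NeZero n] [NeZero n'] : Prop :=
  haveI : NeZero (n + n') := ⟨by have := NeZero.pos n; omega⟩
  ∀ (I : Profile m n) (I' : Profile m n'), F n I = F n' I' →
    F (n + n') (Fin.append I I') = F n I

/-- Reinforcement. -/
def Reinforcement {m : ℕ} (F : AggregationRule m) : Prop :=
  ∀ (n n' : ℕ) [NeZero n] [NeZero n'], ReinforcementFor F n n'

end Portioning

end

open Portioning

noncomputable section

namespace Portioning

/-! ### Order statistics -/

/-! Independence. With two candidates one column determines the whole profile, so every rule is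
independent. Column averages already sum to one, so Avg needs no normalization. For the other
coordinate-wise rules a candidate receives the aggregate of its column divided by the sum of all
aggregates, and independence fails once the remaining columns can be rearranged so that this sum
changes (`not_independence_coordRule`). Egal, Util and IM are refuted on small, mostly single-minded
profiles whose outcomes can be controlled. Candidates of weight zero pad every counterexample to
larger `m`.

Score-monotonicity. For coordinate-wise rules it is the monotonicity of `a / (a + A)`, increasing in
`a` and decreasing in `A` (`normalize_mono`). For Util it is an exchange argument resting on the
convexity of the column costs. For IM, either the stopping time grows and the favoured score rises
with it, or it shrinks and all other scores fall. With two candidates an Egal outcome is the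
midrange of each column, which is monotone; for `m, n ≥ 4` bounds on the largest disutility alone
refute the axiom.

Reinforcement. Each positive case rests on a way to combine two electorates. Aggregates proportional
to `x` combine to aggregates proportional to `x` (`reinforcementFor_coordRule`). Utilitarian welfare
adds up. IM times `t`, `t'` combine to `t * t' / (t + t')`. The leximin order becomes additive once
it is encoded by `∑ exp (K * d i)` for large `K`; hence two electorates with a common Egal outcome
have exactly their common outcomes as joint Egal outcomes, and consistent tie-breaking selects the
same one. Med works for two candidates because middle intervals with a common centre are nested
(`median_append`); for three candidates the normalizing sums of the two electorates may differ, and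
this breaks it. -/

theorem sorted_mono {n : ℕ} {v w : Fin n → ℝ} (h : ∀ i, v i ≤ w i) (k : Fin n) :
    sorted v k ≤ sorted w k := by
  have := sorted_le_add v w 0 (fun i => by linarith [h i]) k
  linarith

theorem median_mono {n : ℕ} [NeZero n] {v w : Fin n → ℝ} (h : ∀ i, v i ≤ w i) :
    median v ≤ median w := by
  have h1 := sorted_mono h ⟨(n - 1) / 2, by have := NeZero.pos n; omega⟩
  have h2 := sorted_mono h ⟨n / 2, by have := NeZero.pos n; omega⟩
  unfold median
  linarith

/-- The lower of the two middle entries of `v`. -/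
def lowerMedian {n : ℕ} [NeZero n] (v : Fin n → ℝ) : ℝ :=
  sorted v ⟨(n - 1) / 2, by have := NeZero.pos n; omega⟩

/-- The upper of the two middle entries of `v`. -/
def upperMedian {n : ℕ} [NeZero n] (v : Fin n → ℝ) : ℝ :=
  sorted v ⟨n / 2, by have := NeZero.pos n; omega⟩

theorem median_eq {n : ℕ} [NeZero n] (v : Fin n → ℝ) :
    median v = (lowerMedian v + upperMedian v) / 2 := rfl

theorem lowerMedian_le_iff {n : ℕ} [NeZero n] (v : Fin n → ℝ) (a : ℝ) :
    lowerMedian v ≤ a ↔ n ≤ 2 * (Finset.univ.filter fun i => v i ≤ a).card := by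
  have := NeZero.pos n
  rw [lowerMedian, sorted_le_iff]
  simp only
  omega

theorem upperMedian_le_iff {n : ℕ} [NeZero n] (v : Fin n → ℝ) (a : ℝ) :
    upperMedian v ≤ a ↔ n < 2 * (Finset.univ.filter fun i => v i ≤ a).card := by
  rw [upperMedian, sorted_le_iff]
  simp only
  omega

theorem lowerMedian_le_upperMedian {n : ℕ} [NeZero n] (v : Fin n → ℝ) :
    lowerMedian v ≤ upperMedian v :=
  (lowerMedian_le_iff v _).2 ((upperMedian_le_iff v _).1 le_rfl).le

theorem card_append_le {n n' : ℕ} (v : Fin n → ℝ) (v' : Fin n' → ℝ) (a : ℝ) :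
    (Finset.univ.filter fun l => Fin.append v v' l ≤ a).card =
      (Finset.univ.filter fun i => v i ≤ a).card + (Finset.univ.filter fun i => v' i ≤ a).card := by
  simp only [Finset.card_filter, Fin.sum_univ_add, Fin.append_left, Fin.append_right]

/-- The middle entries of `v` and of `v'` bound two intervals with the same centre `x`, so one
contains the other. Concatenation intersects these intervals, which keeps the centre. -/
theorem median_append {n n' : ℕ} [NeZero n] [NeZero n'] [NeZero (n + n')] {v : Fin n → ℝ}
    {v' : Fin n' → ℝ} {x : ℝ} (h : median v = x) (h' : median v' = x) :
    median (Fin.append v v') = x := by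
  rw [median_eq] at *
  have lu := lowerMedian_le_upperMedian v
  have lu' := lowerMedian_le_upperMedian v'
  have hL : lowerMedian (Fin.append v v') = max (lowerMedian v) (lowerMedian v') := by
    apply le_antisymm
    · rw [lowerMedian_le_iff, card_append_le]
      have h1 := (lowerMedian_le_iff v _).1 (le_max_left _ (lowerMedian v'))
      have h2 := (lowerMedian_le_iff v' _).1 (le_max_right (lowerMedian v) _)
      omega
    · have hc := (lowerMedian_le_iff (Fin.append v v') _).1 le_rfl
      rw [card_append_le] at hc
      set a := lowerMedian (Fin.append v v')
      refine max_le ?_ ?_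
      -- If fewer than half of `v` is at most `a`, then more than half of `v'` is. This puts the
      -- upper median of `v'` below the lower median of `v`, although `x` separates them the other
      -- way.
      · by_contra hlt
        have h1 := mt (lowerMedian_le_iff v a).2 hlt
        have h2 := (upperMedian_le_iff v' a).2 (by omega)
        push Not at hlt
        linarith
      · by_contra hlt
        have h1 := mt (lowerMedian_le_iff v' a).2 hlt
        have h2 := (upperMedian_le_iff v a).2 (by omega)
        push Not at hlt
        linarith
  have hU : upperMedian (Fin.append v v') = min (upperMedian v) (upperMedian v') := by
    apply le_antisymm
    · refine le_min ?_ ?_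
      · rw [upperMedian_le_iff, card_append_le]
        have h1 := (upperMedian_le_iff v _).1 le_rfl
        have h2 := (lowerMedian_le_iff v' (upperMedian v)).1 (by linarith)
        omega
      · rw [upperMedian_le_iff, card_append_le]
        have h1 := (upperMedian_le_iff v' _).1 le_rfl
        have h2 := (lowerMedian_le_iff v (upperMedian v')).1 (by linarith)
        omega
    · have hc := (upperMedian_le_iff (Fin.append v v') _).1 le_rfl
      rw [card_append_le] at hc
      set a := upperMedian (Fin.append v v')
      rw [min_le_iff, upperMedian_le_iff, upperMedian_le_iff]
      omega
  rw [hL, hU]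
  have : upperMedian v = 2 * x - lowerMedian v := by linarith
  have : upperMedian v' = 2 * x - lowerMedian v' := by linarith
  rcases le_total (lowerMedian v) (lowerMedian v') with hl | hl
  · rw [max_eq_right hl, min_eq_right (by linarith)]; linarith
  · rw [max_eq_left hl, min_eq_left (by linarith)]; linarith

/-- Reflection reverses the order: sorting after reflecting and reversing the sorted original are
two monotone rearrangements of one vector, hence equal. -/
theorem sorted_const_sub {n : ℕ} (v : Fin n → ℝ) (c : ℝ) (k : Fin n) :
    sorted (fun i => c - v i) k = c - sorted v k.rev := by
  have h : (fun i => c - v i) ∘ Tuple.sort (fun i => c - v i) =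
      (fun i => c - v i) ∘ (Fin.revPerm.trans (Tuple.sort v)) := by
    refine Tuple.unique_monotone (Tuple.monotone_sort _) fun i j hij => ?_
    have := Tuple.monotone_sort v (Fin.rev_le_rev.2 hij)
    simpa only [Function.comp_apply, Equiv.trans_apply, Fin.revPerm_apply] using
      sub_le_sub_left this c
  exact congrFun h k

theorem median_const_sub {n : ℕ} [NeZero n] (v : Fin n → ℝ) (c : ℝ) :
    median (fun i => c - v i) = c - median v := by
  have hn := NeZero.pos n
  have h1 : (⟨(n - 1) / 2, by omega⟩ : Fin n).rev = ⟨n / 2, by omega⟩ := by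
    ext; simp only [Fin.val_rev]; omega
  have h2 : (⟨n / 2, by omega⟩ : Fin n).rev = ⟨(n - 1) / 2, by omega⟩ := by
    ext; simp only [Fin.val_rev]; omega
  unfold median
  rw [sorted_const_sub, sorted_const_sub, h1, h2]
  ring

/-- A value with strict majorities on both weak sides is the median. -/
theorem median_eq_of_lt {n : ℕ} [NeZero n] {v : Fin n → ℝ} {a : ℝ}
    (h : n < 2 * (Finset.univ.filter fun i => v i ≤ a).card)
    (h' : n < 2 * (Finset.univ.filter fun i => a ≤ v i).card) : median v = a := by
  have hu := (upperMedian_le_iff v a).2 h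
  have hl : a ≤ lowerMedian v := by
    -- Otherwise at least half of the entries lie strictly below `a`, which leaves no room for a
    -- strict majority at or above `a`.
    by_contra! hlt
    have h1 := (lowerMedian_le_iff v _).1 le_rfl
    have hd : Disjoint (Finset.univ.filter fun i => v i ≤ lowerMedian v)
        (Finset.univ.filter fun i => a ≤ v i) := by
      rw [Finset.disjoint_left]
      intro i hi hi'
      simp only [Finset.mem_filter, Finset.mem_univ, true_and] at hi hi'
      linarith
    have h2 := Finset.card_le_univ (Finset.disjUnion _ _ hd)
    rw [Finset.card_disjUnion, Fintype.card_fin] at h2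
    omega
  have := lowerMedian_le_upperMedian v
  rw [median_eq]
  linarith

theorem median_const {n : ℕ} [NeZero n] (a : ℝ) : median (fun _ : Fin n => a) = a := by
  have := NeZero.pos n
  refine median_eq_of_lt ?_ ?_ <;> simp <;> omega

theorem median_pair (v : Fin 2 → ℝ) : median v = (∑ i, v i) / 2 := by
  have h : ∑ i, sorted v i = ∑ i, v i := Equiv.sum_comp (Tuple.sort v) v
  rw [← h, Fin.sum_univ_two]
  rfl

/-! ### Normalization -/

theorem Dist.nonneg {m : ℕ} (x : Dist m) (j : Fin m) : 0 ≤ x j := x.2.1 j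

theorem Dist.sum_eq_one {m : ℕ} (x : Dist m) : ∑ j, x j = 1 := x.2.2

theorem Dist.le_one {m : ℕ} (x : Dist m) (j : Fin m) : x j ≤ 1 := by
  rw [← x.sum_eq_one]
  exact Finset.single_le_sum (f := fun k => x k) (fun k _ => x.nonneg k) (Finset.mem_univ j)

theorem normalize_apply {m : ℕ} [NeZero m] (a : Fin m → ℝ) (ha : ∀ j, 0 ≤ a j) (j : Fin m) :
    normalize a ha j = if ∑ k, a k = 0 then 1 / (m : ℝ) else a j / ∑ k, a k := rfl

theorem normalize_eq_of_sum_eq_one {m : ℕ} [NeZero m] (a : Fin m → ℝ) (ha : ∀ j, 0 ≤ a j)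
    (h : ∑ k, a k = 1) (j : Fin m) : normalize a ha j = a j := by
  rw [normalize_apply, h, if_neg one_ne_zero, div_one]

/-- This form survives the default case, because a non-negative vector with sum zero vanishes. It
spares later arguments the division and the case split. -/
theorem eq_sum_mul_normalize {m : ℕ} [NeZero m] (a : Fin m → ℝ) (ha : ∀ j, 0 ≤ a j) (j : Fin m) :
    a j = (∑ k, a k) * normalize a ha j := by
  rw [normalize_apply]
  split_ifs with h
  · rw [h, zero_mul]
    exact (Finset.sum_eq_zero_iff_of_nonneg fun k _ => ha k).1 h j (Finset.mem_univ j)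
  · field_simp

theorem normalize_of_eq_mul {m : ℕ} [NeZero m] (a : Fin m → ℝ) (ha : ∀ j, 0 ≤ a j) (x : Dist m)
    {c : ℝ} (hc : c ≠ 0) (h : ∀ j, a j = c * x j) : normalize a ha = x := by
  have hs : ∑ k, a k = c := by
    simp only [h, ← Finset.mul_sum, x.sum_eq_one, mul_one]
  ext j
  rw [normalize_apply, hs, if_neg hc, h]
  field_simp

theorem normalize_of_sum_eq_zero {m : ℕ} [NeZero m] (a : Fin m → ℝ) (ha : ∀ j, 0 ≤ a j)
    (h : ∑ k, a k = 0) (j : Fin m) : normalize a ha j = 1 / m := by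
  rw [normalize_apply, if_pos h]

/-- Write `A` and `B` for the sums of the other entries. Cross-multiplying reduces the claim to `a j
* B ≤ b j * A`. Only the uniform default values need separate care. -/
theorem normalize_mono {m : ℕ} [NeZero m] {a b : Fin m → ℝ} (ha : ∀ j, 0 ≤ a j)
    (hb : ∀ j, 0 ≤ b j) {j : Fin m} (hj : a j ≤ b j) (hk : ∀ k, k ≠ j → b k ≤ a k) :
    normalize a ha j ≤ normalize b hb j := by
  have hsa := Finset.add_sum_erase Finset.univ a (Finset.mem_univ j)
  have hsb := Finset.add_sum_erase Finset.univ b (Finset.mem_univ j)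
  have hle : ∑ k ∈ Finset.univ.erase j, b k ≤ ∑ k ∈ Finset.univ.erase j, a k :=
    Finset.sum_le_sum fun k h => hk k (Finset.ne_of_mem_erase h)
  have hb0 : 0 ≤ ∑ k ∈ Finset.univ.erase j, b k := Finset.sum_nonneg fun k _ => hb k
  have haj := ha j
  have hbj := hb j
  rcases eq_or_ne (∑ k, b k) 0 with hB | hB
  · have : a j = 0 := by linarith
    rw [normalize_of_sum_eq_zero b hb hB, normalize_apply]
    split_ifs
    · exact le_rfl
    · rw [this, zero_div]; positivity
  rcases eq_or_ne (∑ k, a k) 0 with hA | hA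
  -- The left side takes the default `1 / m`, but now `b` is concentrated on `j` and yields `1`.
  · have h0 : ∑ k ∈ Finset.univ.erase j, b k = 0 := by linarith
    have hbs : b j = ∑ k, b k := by linarith
    rw [normalize_of_sum_eq_zero a ha hA, normalize_apply, if_neg hB, ← hbs, div_self (hbs ▸ hB)]
    have hm : (1 : ℝ) ≤ m := by exact_mod_cast NeZero.one_le
    exact (div_le_one (by linarith)).2 hm
  · rw [normalize_apply, normalize_apply, if_neg hA, if_neg hB]
    have hA' : 0 < ∑ k, a k := lt_of_le_of_ne (by linarith) (Ne.symm hA)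
    have hB' : 0 < ∑ k, b k := lt_of_le_of_ne (by linarith) (Ne.symm hB)
    rw [div_le_div_iff₀ hA' hB', ← hsa, ← hsb]
    nlinarith [mul_le_mul hj hle hb0 hbj]

/-! ### Two candidates -/

theorem profile_ext_of_two {n : ℕ} {I I' : Profile 2 n} (j : Fin 2) (h : ∀ i, I i j = I' i j) :
    I = I' := by
  funext i
  have h1 : I i 0 + I i 1 = 1 := by rw [← (I i).sum_eq_one, Fin.sum_univ_two]
  have h2 : I' i 0 + I' i 1 = 1 := by rw [← (I' i).sum_eq_one, Fin.sum_univ_two]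
  have h3 := h i
  ext k
  fin_cases j <;> fin_cases k <;> simp at h3 ⊢ <;> linarith

theorem independence_of_two (F : AggregationRule 2) (n : ℕ) [NeZero n] : Independence F n :=
  fun I I' j h => by rw [profile_ext_of_two j h]

/-! ### Coordinate-wise rules -/

theorem coordRule_apply {m : ℕ} [NeZero m] (f : ∀ (n : ℕ) [NeZero n], (Fin n → ℝ) → ℝ)
    (hf : ∀ (n : ℕ) [NeZero n] (v : Fin n → ℝ), (∀ i, 0 ≤ v i) → 0 ≤ f n v) {n : ℕ} [NeZero n]
    (I : Profile m n) :
    coordRule f hf n I =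
      normalize (fun j => f n fun i => I i j) fun j => hf n _ fun i => (I i).2.1 j := rfl

theorem coordRule_eq_of_sum_eq_one {m : ℕ} [NeZero m]
    (f : ∀ (n : ℕ) [NeZero n], (Fin n → ℝ) → ℝ)
    (hf : ∀ (n : ℕ) [NeZero n] (v : Fin n → ℝ), (∀ i, 0 ≤ v i) → 0 ≤ f n v) {n : ℕ} [NeZero n]
    (I : Profile m n) (h : ∑ j, f n (fun i => I i j) = 1) (j : Fin m) :
    coordRule f hf n I j = f n fun i => I i j :=
  normalize_eq_of_sum_eq_one _ (fun j => hf n _ fun i => (I i).2.1 j) h j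

theorem score_le_of_change {m n : ℕ} {I I' : Profile m n} {i : Fin n} {j : Fin m}
    (hl : ∀ l, l ≠ i → I l = I' l) (hj : I i j < I' i j) (l : Fin n) : I l j ≤ I' l j := by
  rcases eq_or_ne l i with rfl | h
  · exact hj.le
  · rw [hl l h]

theorem score_ge_of_change {m n : ℕ} {I I' : Profile m n} {i : Fin n} {j : Fin m}
    (hl : ∀ l, l ≠ i → I l = I' l) (hk : ∀ k, k ≠ j → I' i k ≤ I i k) {k : Fin m} (hkj : k ≠ j)
    (l : Fin n) : I' l k ≤ I l k := by
  rcases eq_or_ne l i with rfl | h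
  · exact hk k hkj
  · rw [hl l h]

theorem scoreMonotone_coordRule {m : ℕ} [NeZero m] (f : ∀ (n : ℕ) [NeZero n], (Fin n → ℝ) → ℝ)
    (hf : ∀ (n : ℕ) [NeZero n] (v : Fin n → ℝ), (∀ i, 0 ≤ v i) → 0 ≤ f n v) (n : ℕ) [NeZero n]
    (hmono : ∀ v w : Fin n → ℝ, (∀ i, 0 ≤ v i) → (∀ i, v i ≤ w i) → f n v ≤ f n w) :
    ScoreMonotone (coordRule f hf : AggregationRule m) n := by
  rintro I I' j ⟨i, hl, hj, hk⟩
  refine normalize_mono _ _ ?_ fun k hkj => ?_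
  · exact hmono _ _ (fun l => (I l).nonneg j) (score_le_of_change hl hj)
  · exact hmono _ _ (fun l => (I' l).nonneg k) (score_ge_of_change hl hk hkj)

/-- If the common outcome is `x`, the column aggregates are `S * x j` and `S' * x j`. It therefore
suffices that the joint aggregate is again a multiple of `x j`, with a factor `h S S'` that is the
same for all candidates. -/
theorem reinforcementFor_coordRule {m : ℕ} [NeZero m]
    (f : ∀ (n : ℕ) [NeZero n], (Fin n → ℝ) → ℝ)
    (hf : ∀ (n : ℕ) [NeZero n] (v : Fin n → ℝ), (∀ i, 0 ≤ v i) → 0 ≤ f n v) (n n' : ℕ) [NeZero n]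
    [NeZero n'] (h : ℝ → ℝ → ℝ)
    (h0 : ∀ S S', 0 ≤ S → 0 ≤ S' → h S S' = 0 → S = 0 ∨ S' = 0)
    (happ : ∀ [NeZero (n + n')] (v : Fin n → ℝ) (v' : Fin n' → ℝ) (S S' x : ℝ), (∀ i, 0 ≤ v i) →
      (∀ i, 0 ≤ v' i) → 0 ≤ S → 0 ≤ S' → 0 ≤ x → f n v = S * x → f n' v' = S' * x →
        f (n + n') (Fin.append v v') = h S S' * x) :
    ReinforcementFor (coordRule f hf : AggregationRule m) n n' := by
  have : NeZero (n + n') := ⟨by have := NeZero.pos n; omega⟩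
  intro I I' hII
  obtain ⟨x, hx⟩ : ∃ x, x = coordRule f hf n I := ⟨_, rfl⟩
  have ha : ∀ j, 0 ≤ f n fun i => I i j := fun j => hf n _ fun i => (I i).nonneg j
  have ha' : ∀ j, 0 ≤ f n' fun i => I' i j := fun j => hf n' _ fun i => (I' i).nonneg j
  obtain ⟨S, hS⟩ : ∃ S, S = ∑ j, f n fun i => I i j := ⟨_, rfl⟩
  obtain ⟨S', hS'⟩ : ∃ S', S' = ∑ j, f n' fun i => I' i j := ⟨_, rfl⟩
  have hS0 : 0 ≤ S := hS ▸ Finset.sum_nonneg fun j _ => ha j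
  have hS0' : 0 ≤ S' := hS' ▸ Finset.sum_nonneg fun j _ => ha' j
  have e : ∀ j, (f n fun i => I i j) = S * x j := fun j => by
    rw [hx, coordRule_apply, hS]
    exact eq_sum_mul_normalize _ ha j
  have e' : ∀ j, (f n' fun i => I' i j) = S' * x j := fun j => by
    rw [hx, hII, coordRule_apply, hS']
    exact eq_sum_mul_normalize _ ha' j
  have hb : ∀ j, (f (n + n') fun l => Fin.append I I' l j) = h S S' * x j := fun j => by
    rw [← happ _ _ S S' (x j) (fun i => (I i).nonneg j) (fun i => (I' i).nonneg j) hS0 hS0'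
      (x.nonneg j) (e j) (e' j)]
    congr 1
    funext l
    refine Fin.addCases (fun i => ?_) (fun i => ?_) l
    · simp only [Fin.append_left]
    · simp only [Fin.append_right]
  rw [← hx]
  rcases eq_or_ne (h S S') 0 with hz | hz
  -- A vanishing joint factor sends the joint instance to the uniform default. By `h0` one of the
  -- two electorates was in the default case too, so `x` is already uniform.
  · have hu : ∀ j, x j = 1 / m := fun j => by
      rcases h0 S S' hS0 hS0' hz with h | h
      · rw [hx]
        exact normalize_of_sum_eq_zero _ ha (hS ▸ h) j
      · rw [hx, hII]
        exact normalize_of_sum_eq_zero _ ha' (hS' ▸ h) j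
    ext j
    rw [hu]
    refine normalize_of_sum_eq_zero _ _ ?_ j
    simp only [hb, hz, zero_mul, Finset.sum_const_zero]
  · exact normalize_of_eq_mul _ _ x hz hb

theorem sum_scores_eq {m n : ℕ} (I : Profile m n) : ∑ j, ∑ i, I i j = n := by
  rw [Finset.sum_comm]
  simp only [Dist.sum_eq_one, Finset.sum_const, Finset.card_univ, Fintype.card_fin, nsmul_eq_mul,
    mul_one]

/-- Column averages sum to one, so the normalization is inactive and each output depends on a single
column. -/
theorem avgRule_apply {m n : ℕ} [NeZero m] [NeZero n] (I : Profile m n) (j : Fin m) :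
    avgRule m n I j = (∑ i, I i j) / n := by
  refine coordRule_eq_of_sum_eq_one _ _ I ?_ j
  rw [← Finset.sum_div, sum_scores_eq, div_self (Nat.cast_ne_zero.2 (NeZero.ne n))]

theorem independence_avgRule (m n : ℕ) [NeZero m] [NeZero n] : Independence (avgRule m) n :=
  fun I I' j h => by simp only [avgRule_apply, h]

theorem medRule_pair {m : ℕ} [NeZero m] (I : Profile m 2) : medRule m 2 I = avgRule m 2 I := by
  have h : ∀ v : Fin 2 → ℝ, median v = (∑ i, v i) / ((2 : ℕ) : ℝ) := fun v => by
    rw [median_pair]; norm_num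
  ext j
  simp only [medRule, avgRule, coordRule_apply, h]

/-! ### Score-monotonicity of the coordinate-wise rules -/

theorem scoreMonotone_avgRule (m n : ℕ) [NeZero m] [NeZero n] : ScoreMonotone (avgRule m) n :=
  scoreMonotone_coordRule _ _ n fun _ _ _ h =>
    div_le_div_of_nonneg_right (Finset.sum_le_sum fun i _ => h i) (Nat.cast_nonneg _)

theorem scoreMonotone_maxRule (m n : ℕ) [NeZero m] [NeZero n] : ScoreMonotone (maxRule m) n :=
  scoreMonotone_coordRule _ _ n fun _ w _ h => Finset.sup'_le _ _ fun i hi =>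
    (h i).trans (Finset.le_sup' w hi)

theorem scoreMonotone_minRule (m n : ℕ) [NeZero m] [NeZero n] : ScoreMonotone (minRule m) n :=
  scoreMonotone_coordRule _ _ n fun v _ _ h => Finset.le_inf' _ _ fun i hi =>
    (Finset.inf'_le v hi).trans (h i)

theorem scoreMonotone_medRule (m n : ℕ) [NeZero m] [NeZero n] : ScoreMonotone (medRule m) n :=
  scoreMonotone_coordRule _ _ n fun _ _ _ h => median_mono h

theorem scoreMonotone_geoRule (m n : ℕ) [NeZero m] [NeZero n] : ScoreMonotone (geoRule m) n :=
  scoreMonotone_coordRule _ _ n fun _ _ h0 h => Real.rpow_le_rpow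
    (Finset.prod_nonneg fun i _ => h0 i) (Finset.prod_le_prod (fun i _ => h0 i) fun i _ => h i)
    (by positivity)

/-! ### Reinforcement of the coordinate-wise rules -/

theorem reinforcement_avgRule (m : ℕ) [NeZero m] : Reinforcement (avgRule m) := by
  intro n n' _ _
  have hn : (0 : ℝ) < n := Nat.cast_pos.2 (NeZero.pos n)
  have hn' : (0 : ℝ) < n' := Nat.cast_pos.2 (NeZero.pos n')
  refine reinforcementFor_coordRule _ _ n n' (fun S S' => (n * S + n' * S') / (n + n')) ?_ ?_
  · intro S S' hS hS' h
    left
    rw [div_eq_zero_iff] at h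
    rcases h with h | h
    · nlinarith [mul_nonneg hn.le hS, mul_nonneg hn'.le hS']
    · linarith
  · intro _ v v' S S' x _ _ _ _ _ h h'
    simp only [Fin.sum_univ_add, Fin.append_left, Fin.append_right]
    rw [div_eq_iff hn.ne'] at h
    rw [div_eq_iff hn'.ne'] at h'
    rw [h, h']
    push_cast
    field_simp

theorem reinforcement_maxRule (m : ℕ) [NeZero m] : Reinforcement (maxRule m) := by
  intro n n' _ _
  refine reinforcementFor_coordRule _ _ n n' max ?_ ?_
  · intro S S' hS hS' h
    exact Or.inl (le_antisymm (h ▸ le_max_left S S') hS)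
  · intro _ v v' S S' x _ _ _ _ hx h h'
    rw [max_mul_of_nonneg _ _ hx, ← h, ← h']
    apply le_antisymm
    · refine Finset.sup'_le _ _ fun l _ => ?_
      refine Fin.addCases (fun i => ?_) (fun i => ?_) l
      · rw [Fin.append_left]
        exact le_max_of_le_left (Finset.le_sup' v (Finset.mem_univ i))
      · rw [Fin.append_right]
        exact le_max_of_le_right (Finset.le_sup' v' (Finset.mem_univ i))
    · refine max_le (Finset.sup'_le _ _ fun i _ => ?_) (Finset.sup'_le _ _ fun i _ => ?_)
      · rw [← Fin.append_left v v' i]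
        exact Finset.le_sup' (Fin.append v v') (Finset.mem_univ _)
      · rw [← Fin.append_right v v' i]
        exact Finset.le_sup' (Fin.append v v') (Finset.mem_univ _)

theorem reinforcement_minRule (m : ℕ) [NeZero m] : Reinforcement (minRule m) := by
  intro n n' _ _
  refine reinforcementFor_coordRule _ _ n n' min ?_ ?_
  · intro S S' hS hS' h
    rcases min_choice S S' with e | e
    · exact Or.inl (e ▸ h)
    · exact Or.inr (e ▸ h)
  · intro _ v v' S S' x _ _ _ _ hx h h'
    rw [min_mul_of_nonneg _ _ hx, ← h, ← h']
    apply le_antisymm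
    · refine le_min (Finset.le_inf' _ _ fun i _ => ?_) (Finset.le_inf' _ _ fun i _ => ?_)
      · rw [← Fin.append_left v v' i]
        exact Finset.inf'_le (Fin.append v v') (Finset.mem_univ _)
      · rw [← Fin.append_right v v' i]
        exact Finset.inf'_le (Fin.append v v') (Finset.mem_univ _)
    · refine Finset.le_inf' _ _ fun l _ => ?_
      refine Fin.addCases (fun i => ?_) (fun i => ?_) l
      · rw [Fin.append_left]
        exact min_le_of_left_le (Finset.inf'_le v (Finset.mem_univ i))
      · rw [Fin.append_right]
        exact min_le_of_right_le (Finset.inf'_le v' (Finset.mem_univ i))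

theorem reinforcement_geoRule (m : ℕ) [NeZero m] : Reinforcement (geoRule m) := by
  intro n n' _ _
  have hn := NeZero.ne n
  have hn' := NeZero.ne n'
  -- The joint factor is the geometric mean of `S` and `S'`, weighted by the sizes of the
  -- electorates.
  refine reinforcementFor_coordRule _ _ n n'
    (fun S S' => (S ^ n * S' ^ n') ^ (((n + n' : ℕ) : ℝ)⁻¹)) ?_ ?_
  · intro S S' hS hS' h
    rw [Real.rpow_eq_zero (by positivity) (by positivity), mul_eq_zero] at h
    exact h.imp eq_zero_of_pow_eq_zero eq_zero_of_pow_eq_zero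
  · intro _ v v' S S' x hv hv' hS hS' hx h h'
    simp only [Fin.prod_univ_add, Fin.append_left, Fin.append_right, one_div] at h h' ⊢
    rw [← Real.rpow_inv_natCast_pow (Finset.prod_nonneg fun i _ => hv i) hn, h,
      ← Real.rpow_inv_natCast_pow (Finset.prod_nonneg fun i _ => hv' i) hn', h']
    have : (S * x) ^ n * (S' * x) ^ n' = (S ^ n * S' ^ n') * x ^ (n + n') := by ring
    rw [this, Real.mul_rpow (by positivity) (by positivity),
      Real.pow_rpow_inv_natCast hx (NeZero.ne _)]

/-- The two columns are reflections of each other, so their medians sum to one and need no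
normalization. -/
theorem medRule_two_apply {n : ℕ} [NeZero n] (I : Profile 2 n) (j : Fin 2) :
    medRule 2 n I j = median fun i => I i j := by
  refine coordRule_eq_of_sum_eq_one _ _ I ?_ j
  have h : (fun i => I i 1) = fun i => 1 - I i 0 := by
    funext i
    have := (I i).sum_eq_one
    rw [Fin.sum_univ_two] at this
    linarith
  rw [Fin.sum_univ_two, h, median_const_sub]
  ring

theorem append_apply_candidate {m n n' : ℕ} (I : Profile m n) (I' : Profile m n') (j : Fin m) :
    (fun l => Fin.append I I' l j) = Fin.append (fun i => I i j) fun i => I' i j := by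
  funext l
  refine Fin.addCases (fun i => ?_) (fun i => ?_) l
  · simp only [Fin.append_left]
  · simp only [Fin.append_right]

theorem reinforcement_medRule_two : Reinforcement (medRule 2) := by
  intro n n' _ _
  have : NeZero (n + n') := ⟨by have := NeZero.pos n; omega⟩
  intro I I' h
  ext j
  rw [medRule_two_apply, append_apply_candidate]
  refine median_append (medRule_two_apply I j).symm ?_
  rw [h, medRule_two_apply]

/-! ### The utilitarian rule -/

/-- The cost of assigning the value `z` to a candidate with scores `v`. -/
def columnCost {n : ℕ} (v : Fin n → ℝ) (z : ℝ) : ℝ := ∑ i, |v i - z|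

theorem utilWelfare_eq {m n : ℕ} (I : Profile m n) (x : Dist m) :
    utilWelfare I x = -∑ j, columnCost (fun i => I i j) (x j) := by
  unfold utilWelfare disutility columnCost
  rw [Finset.sum_comm]

theorem abs_add_sub_abs_mono {u w ε : ℝ} (h : u ≤ w) (hε : 0 ≤ ε) :
    |u + ε| - |u| ≤ |w + ε| - |w| := by
  rcases abs_cases (u + ε) with h1 | h1 <;> rcases abs_cases u with h2 | h2 <;>
    rcases abs_cases (w + ε) with h3 | h3 <;> rcases abs_cases w with h4 | h4 <;> linarith

/-- Convexity of the absolute value: a step of length `ε` costs more from a higher starting point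
and less when the scores are higher. -/
theorem columnCost_increment_mono {n : ℕ} {v v' : Fin n → ℝ} {a b ε : ℝ} (hv : ∀ i, v i ≤ v' i)
    (hab : a ≤ b) (hε : 0 ≤ ε) :
    columnCost v' (a + ε) - columnCost v' a ≤ columnCost v (b + ε) - columnCost v b := by
  unfold columnCost
  rw [← Finset.sum_sub_distrib, ← Finset.sum_sub_distrib]
  refine Finset.sum_le_sum fun i _ => ?_
  have := abs_add_sub_abs_mono (u := a - v' i) (w := b - v i) (by linarith [hv i]) hε
  rw [abs_sub_comm (v' i), abs_sub_comm (v' i), abs_sub_comm (v i), abs_sub_comm (v i),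
    add_sub_right_comm, add_sub_right_comm]
  exact this

/-- Move an amount `ε` from candidate `j` to candidate `k`. -/
def transfer {m : ℕ} (x : Dist m) (j k : Fin m) (ε : ℝ) (h0 : 0 ≤ ε) (hj : ε ≤ x j) : Dist m :=
  ⟨fun l => x l + (if l = k then ε else 0) - (if l = j then ε else 0), by
    refine ⟨fun l => ?_, ?_⟩
    · have := x.nonneg l
      dsimp only
      split_ifs with h1 h2 h2
      · linarith
      · linarith
      · rw [h2]; linarith
      · linarith
    · simp [Finset.sum_sub_distrib, Finset.sum_add_distrib, x.sum_eq_one]⟩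

theorem sum_transfer {m : ℕ} (x : Dist m) {j k : Fin m} (hjk : j ≠ k) (ε : ℝ) (h0 : 0 ≤ ε)
    (hj : ε ≤ x j) (g : Fin m → ℝ → ℝ) :
    ∑ l, g l (transfer x j k ε h0 hj l) =
      ∑ l, g l (x l) + (g j (x j - ε) - g j (x j)) + (g k (x k + ε) - g k (x k)) := by
  have hl : ∀ l, transfer x j k ε h0 hj l =
      x l + (if l = k then ε else 0) - (if l = j then ε else 0) := fun _ => rfl
  have := Fintype.sum_eq_add (f := fun l => g l (transfer x j k ε h0 hj l) - g l (x l)) j k hjk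
    fun l h => by simp [hl, h.1, h.2]
  rw [Finset.sum_sub_distrib] at this
  simp only [hl, hjk, hjk.symm, if_true, if_false, add_zero, sub_zero] at this ⊢
  linarith

/-- If `j` lost weight, some other candidate `k` gained. Moving `ε` from `j` to `k` in the old
outcome and back in the new one does not increase the total cost over both instances, by convexity.
Both outcomes being optimal, both moves are ties, and then the distances to uniform contradict each
other. -/
theorem scoreMonotone_utilRule (m n : ℕ) [NeZero m] [NeZero n] : ScoreMonotone (utilRule m) n := by
  rintro I I' j ⟨i, hl, hj, hk⟩
  obtain ⟨o1, o2⟩ := util_spec I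
  obtain ⟨o1', o2'⟩ := util_spec I'
  set x := utilRule m n I
  set x' := utilRule m n I'
  by_contra! hlt
  obtain ⟨k, hkj, hkx⟩ : ∃ k, k ≠ j ∧ x k < x' k := by
    by_contra! hno
    have h1 := Finset.add_sum_erase Finset.univ (fun k => x k) (Finset.mem_univ j)
    have h2 := Finset.add_sum_erase Finset.univ (fun k => x' k) (Finset.mem_univ j)
    have h3 : ∑ k ∈ Finset.univ.erase j, x' k ≤ ∑ k ∈ Finset.univ.erase j, x k :=
      Finset.sum_le_sum fun k h => hno k (Finset.ne_of_mem_erase h)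
    simp only [Dist.sum_eq_one] at h1 h2
    linarith
  -- Half of the smaller gap: after both moves the values have still not crossed, as the increment
  -- comparisons require.
  obtain ⟨ε, hε, hεj, hεk⟩ : ∃ ε > 0, x' j + 2 * ε ≤ x j ∧ x k + 2 * ε ≤ x' k := by
    refine ⟨min (x j - x' j) (x' k - x k) / 2, half_pos (lt_min (by linarith) (by linarith)), ?_, ?_⟩
    · linarith [min_le_left (x j - x' j) (x' k - x k)]
    · linarith [min_le_right (x j - x' j) (x' k - x k)]
  have hxj : ε ≤ x j := by linarith [x'.nonneg j]
  have hxk : ε ≤ x' k := by linarith [x.nonneg k]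
  have wy : utilWelfare I (transfer x j k ε hε.le hxj) = _ := utilWelfare_eq _ _
  have wy' : utilWelfare I' (transfer x' k j ε hε.le hxk) = _ := utilWelfare_eq _ _
  rw [sum_transfer x hkj.symm ε hε.le hxj fun l => columnCost fun i => I i l] at wy
  rw [sum_transfer x' hkj ε hε.le hxk fun l => columnCost fun i => I' i l] at wy'
  have wx := utilWelfare_eq I x
  have wx' := utilWelfare_eq I' x'
  have c1 := columnCost_increment_mono (score_le_of_change hl hj)
    (show x' j ≤ x j - ε by linarith) hε.le
  have c2 := columnCost_increment_mono (score_ge_of_change hl hk hkj)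
    (show x k ≤ x' k - ε by linarith) hε.le
  rw [sub_add_cancel] at c1 c2
  have b1 := o1 (transfer x j k ε hε.le hxj)
  have b1' := o1' (transfer x' k j ε hε.le hxk)
  -- `b1` and `b1'` bound each welfare change from above by zero, while `c1` and `c2` bound the sum
  -- of the changes from below by zero. Hence both transferred outcomes are maximizers.
  have d := o2 (transfer x j k ε hε.le hxj) fun z => (o1 z).trans (by linarith)
  have d' := o2' (transfer x' k j ε hε.le hxk) fun z => (o1' z).trans (by linarith)
  unfold distUniform at d d'
  rw [sum_transfer x hkj.symm ε hε.le hxj fun _ z => (z - 1 / (m : ℝ)) ^ 2] at d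
  rw [sum_transfer x' hkj ε hε.le hxk fun _ z => (z - 1 / (m : ℝ)) ^ 2] at d'
  have e : 0 ≤ ε * (2 * (x k - x j) + 2 * ε) := by linarith
  have e' : 0 ≤ ε * (2 * (x' j - x' k) + 2 * ε) := by linarith
  -- Tie-breaking gives `x j - x k ≤ ε` and `x' k - x' j ≤ ε`. The sum of these left sides is at
  -- least `4 * ε` by the choice of `ε`.
  have f := nonneg_of_mul_nonneg_right e hε
  have f' := nonneg_of_mul_nonneg_right e' hε
  linarith

theorem utilWelfare_append {m n n' : ℕ} (I : Profile m n) (I' : Profile m n') (x : Dist m) :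
    utilWelfare (Fin.append I I') x = utilWelfare I x + utilWelfare I' x := by
  simp only [utilWelfare, Fin.sum_univ_add, Fin.append_left, Fin.append_right, neg_add]

/-- Welfare is additive and `x` maximizes both summands, so every joint maximizer maximizes each
summand. The joint tie-breaking thus ranges over maximizers of `I` only, among which `x` already
wins. -/
theorem reinforcement_utilRule (m : ℕ) [NeZero m] : Reinforcement (utilRule m) := by
  intro n n' _ _
  have : NeZero (n + n') := ⟨by have := NeZero.pos n; omega⟩
  intro I I' h
  obtain ⟨o1, o2⟩ := util_spec I
  obtain ⟨o1', -⟩ := util_spec I'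
  rw [← h] at o1'
  refine isUtilOutcome_unique (Fin.append I I') _ _ (util_spec _) ⟨fun y => ?_, fun y hy => ?_⟩
  · rw [utilWelfare_append, utilWelfare_append]
    exact add_le_add (o1 y) (o1' y)
  · refine o2 y fun z => (o1 z).trans ?_
    have h1 := hy (utilRule m n I)
    rw [utilWelfare_append, utilWelfare_append] at h1
    linarith [o1' y]

/-! ### The independent markets rule -/

theorem card_le_eq_sub {n : ℕ} (v : Fin n → ℝ) (a : ℝ) :
    (Finset.univ.filter fun i => v i ≤ a).card + (Finset.univ.filter fun i => a < v i).card = n := by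
  have := Finset.card_filter_add_card_filter_not (s := Finset.univ) fun i => v i ≤ a
  simpa only [not_le, Finset.card_univ, Fintype.card_fin] using this

theorem phantom_mono {k l : ℕ} (h : k ≤ l) {t : ℝ} (ht : 0 ≤ t) : phantom k t ≤ phantom l t :=
  min_le_min_right _ (mul_le_mul_of_nonneg_right (Nat.cast_le.2 h) ht)

theorem phantom_mono_time (k : ℕ) {t u : ℝ} (h : t ≤ u) : phantom k t ≤ phantom k u :=
  min_le_min_right _ (mul_le_mul_of_nonneg_left h (Nat.cast_nonneg _))

/-- If `c` agents exceed `a`, the median of the `2 * n + 1` values is at most `a` exactly when `c +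
1` phantoms are. Phantoms increase with the index, which starts at `0`, so the phantom with index
`c` decides. -/
theorem imScore_le_iff {m n : ℕ} (I : Profile m n) {t : ℝ} (ht : 0 ≤ t) (j : Fin m) (a : ℝ) :
    imScore I t j ≤ a ↔ phantom (Finset.univ.filter fun i => a < I i j).card t ≤ a := by
  have hc := card_le_eq_sub (fun i => I i j) a
  rw [imScore_eq_sorted, sorted_le_iff, card_append_le]
  simp only
  set c := (Finset.univ.filter fun i => a < I i j).card
  set P := Finset.univ.filter fun k : Fin (n + 1) => phantom k t ≤ a
  have key : c < P.card ↔ phantom c t ≤ a := by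
    have hcn : c < n + 1 := by omega
    constructor
    · intro h
      by_contra hlt
      have hsub : P ⊆ Finset.Iio ⟨c, hcn⟩ := by
        intro k hk
        rw [Finset.mem_Iio, Fin.lt_def]
        by_contra! hle
        exact hlt ((phantom_mono hle ht).trans (Finset.mem_filter.1 hk).2)
      have := Finset.card_le_card hsub
      rw [Fin.card_Iio] at this
      simp only at this
      omega
    · intro h
      have hsub : Finset.Iic ⟨c, hcn⟩ ⊆ P := by
        intro k hk
        rw [Finset.mem_Iic, Fin.le_def] at hk
        exact Finset.mem_filter.2 ⟨Finset.mem_univ _, (phantom_mono hk ht).trans h⟩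
      have := Finset.card_le_card hsub
      rw [Fin.card_Iic] at this
      simp only at this
      omega
  rw [← key]
  omega

theorem imScore_mono {m n : ℕ} {I I' : Profile m n} {t u : ℝ} (htu : t ≤ u) {j : Fin m}
    (h : ∀ i, I i j ≤ I' i j) : imScore I t j ≤ imScore I' u j := by
  refine median_mono fun l => ?_
  refine Fin.addCases (fun i => ?_) (fun k => ?_) l
  · rw [Fin.append_left, Fin.append_left]
    exact h i
  · rw [Fin.append_right, Fin.append_right]
    exact phantom_mono_time k htu

theorem imRule_apply {m n : ℕ} [NeZero n] (I : Profile m n) (j : Fin m) :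
    imRule m n I j = imScore I (imTime I) j := rfl

/-- If the time does not decrease, the score of `j` rises directly. Otherwise no other score rises,
and `j` receives the remainder. -/
theorem scoreMonotone_imRule (m n : ℕ) [NeZero n] : ScoreMonotone (imRule m) n := by
  rintro I I' j ⟨i, hl, hj, hk⟩
  rcases le_total (imTime I) (imTime I') with h | h
  · exact imScore_mono h (score_le_of_change hl hj)
  · have h1 := Finset.add_sum_erase Finset.univ (fun k => imRule m n I k) (Finset.mem_univ j)
    have h2 := Finset.add_sum_erase Finset.univ (fun k => imRule m n I' k) (Finset.mem_univ j)
    have h3 : ∑ k ∈ Finset.univ.erase j, imRule m n I' k ≤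
        ∑ k ∈ Finset.univ.erase j, imRule m n I k :=
      Finset.sum_le_sum fun k hkj =>
        imScore_mono h (score_ge_of_change hl hk (Finset.ne_of_mem_erase hkj))
    simp only [Dist.sum_eq_one] at h1 h2
    linarith

theorem imTime_nonneg {m n : ℕ} [NeZero n] (I : Profile m n) : 0 ≤ imTime I :=
  (isLeast_imTime I).1.1.1

theorem imTime_pos {m n : ℕ} [NeZero n] (I : Profile m n) : 0 < imTime I := by
  refine lt_of_le_of_ne (imTime_nonneg I) fun h => ?_
  have hs : ∑ j, imScore I (imTime I) j = 1 := (isLeast_imTime I).1.2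
  have : ∑ j, imScore I (imTime I) j ≤ 0 := Finset.sum_nonpos fun j _ => by
    rw [imScore_le_iff I (imTime_nonneg I), ← h]
    simp [phantom]
  linarith

/-- A time at which the scores sum up to one yields the outcome of the rule, even if it is not
the smallest one. -/
theorem imRule_eq_of_mem_imTimes {m n : ℕ} [NeZero n] (I : Profile m n) {t : ℝ}
    (ht : t ∈ imTimes I) (j : Fin m) : imRule m n I j = imScore I t j := by
  -- Scores are non-decreasing in time, so equal sums force equality in every coordinate.
  have hle : ∀ j, imScore I (imTime I) j ≤ imScore I t j := fun j =>
    imScore_mono ((isLeast_imTime I).2 ht) fun _ => le_rfl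
  have hs : ∑ j, imScore I (imTime I) j = ∑ j, imScore I t j :=
    (isLeast_imTime I).1.2.trans ht.2.symm
  exact (Finset.sum_eq_sum_iff_of_le fun j _ => hle j).1 hs j (Finset.mem_univ j)

/-- At time `T = t * t' / (t + t')`, the number `(c + c') * T` is a convex combination of `c * t`
and `c' * t'`. By `imScore_le_iff`, both lie on the same side of `a`, depending on whether `x j ≤
a`; so the joint median at `T` is again `x j`. The cap at `1` is common to all phantoms. -/
theorem reinforcement_imRule (m : ℕ) : Reinforcement (imRule m) := by
  intro n n' _ _
  have : NeZero (n + n') := ⟨by have := NeZero.pos n; omega⟩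
  intro I I' hII
  obtain ⟨x, hx⟩ : ∃ x, x = imRule m n I := ⟨_, rfl⟩
  rw [← hx]
  obtain ⟨t, ht⟩ : ∃ t, t = imTime I := ⟨_, rfl⟩
  obtain ⟨t', ht'⟩ : ∃ t', t' = imTime I' := ⟨_, rfl⟩
  have t0 : 0 < t := ht ▸ imTime_pos I
  have t0' : 0 < t' := ht' ▸ imTime_pos I'
  have t1 : t ≤ 1 := ht ▸ (isLeast_imTime I).1.1.2
  have hs : ∀ j, imScore I t j = x j := fun j => by rw [hx, ht]; rfl
  have hs' : ∀ j, imScore I' t' j = x j := fun j => by rw [hx, hII, ht']; rfl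
  obtain ⟨T, hT⟩ : ∃ T, T = t * t' / (t + t') := ⟨_, rfl⟩
  have hT0 : 0 < T := hT ▸ by positivity
  have hT1 : T ≤ 1 := by
    rw [hT, div_le_one (by positivity)]
    nlinarith
  have hcomb : ∀ j, imScore (Fin.append I I') T j = x j := by
    intro j
    refine eq_of_forall_ge_iff fun a => ?_
    have h1 : x j ≤ a ↔ _ := hs j ▸ imScore_le_iff I t0.le j a
    have h2 : x j ≤ a ↔ _ := hs' j ▸ imScore_le_iff I' t0'.le j a
    rw [imScore_le_iff _ hT0.le]
    have hcard : (Finset.univ.filter fun l => a < Fin.append I I' l j).card =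
        (Finset.univ.filter fun i => a < I i j).card +
          (Finset.univ.filter fun i => a < I' i j).card := by
      simp only [Finset.card_filter, Fin.sum_univ_add, Fin.append_left, Fin.append_right]
    rw [hcard]
    generalize (Finset.univ.filter fun i => a < I i j).card = c at *
    generalize (Finset.univ.filter fun i => a < I' i j).card = c' at *
    unfold phantom at *
    have hconv : ((c + c' : ℕ) : ℝ) * T = (t' * (c * t) + t * (c' * t')) / (t + t') := by
      rw [hT]; push_cast; field_simp
    have htt : 0 < t + t' := by positivity
    constructor
    · intro h
      by_contra hxa
      have g1 := mt h1.2 hxa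
      have g2 := mt h2.2 hxa
      rw [min_le_iff, not_or, not_le, not_le] at g1 g2
      rw [min_le_iff, or_iff_left (not_le.2 g1.2), hconv, div_le_iff₀ htt] at h
      nlinarith [mul_lt_mul_of_pos_left g1.1 t0', mul_lt_mul_of_pos_left g2.1 t0]
    · intro hxa
      have g1 := h1.1 hxa
      have g2 := h2.1 hxa
      rw [min_le_iff] at g1 g2 ⊢
      rcases g1 with g1 | g1
      · rcases g2 with g2 | g2
        · left
          rw [hconv, div_le_iff₀ htt]
          nlinarith [mul_le_mul_of_nonneg_left g1 t0'.le, mul_le_mul_of_nonneg_left g2 t0.le]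
        · exact Or.inr g2
      · exact Or.inr g1
  have hmem : T ∈ imTimes (Fin.append I I') :=
    ⟨⟨hT0.le, hT1⟩, by simp only [hcomb, x.sum_eq_one]⟩
  ext j
  rw [imRule_eq_of_mem_imTimes _ hmem, hcomb]

/-! ### Egalitarian outcomes -/

theorem disutility_nonneg {m : ℕ} (s x : Dist m) : 0 ≤ disutility s x :=
  Finset.sum_nonneg fun _ _ => abs_nonneg _

theorem eq_of_disutility_le_zero {m : ℕ} {s x : Dist m} (h : disutility s x ≤ 0) : x = s := by
  have h0 := (Finset.sum_eq_zero_iff_of_nonneg fun j _ => abs_nonneg (s j - x j)).1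
    (le_antisymm h (disutility_nonneg s x))
  ext j
  exact (sub_eq_zero.1 (abs_eq_zero.1 (h0 j (Finset.mem_univ j)))).symm

theorem disutilityVector_zero_le_iff {m n : ℕ} [NeZero n] (I : Profile m n) (x : Dist m) (c : ℝ) :
    disutilityVector I x 0 ≤ c ↔ ∀ i, disutility (I i) x ≤ c := by
  have hn := NeZero.pos n
  unfold disutilityVector
  rw [sorted_le_iff, Fin.val_rev, Fin.val_zero]
  have hle := Finset.card_le_univ (Finset.univ.filter fun i => disutility (I i) x ≤ c)
  rw [Fintype.card_fin] at hle
  have h : (n - (0 + 1) < (Finset.univ.filter fun i => disutility (I i) x ≤ c).card) ↔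
      (Finset.univ.filter fun i => disutility (I i) x ≤ c).card =
        (Finset.univ : Finset (Fin n)).card := by
    rw [Finset.card_univ, Fintype.card_fin]
    omega
  rw [h, Finset.card_filter_eq_iff]
  simp

theorem apply_zero_le_of_toLex_le {n : ℕ} [NeZero n] {a b : Fin n → ℝ} (h : toLex a ≤ toLex b) :
    a 0 ≤ b 0 := by
  by_contra! hlt
  exact absurd h (not_le.2 ⟨0, fun j hj => absurd hj (Fin.not_lt_zero j), hlt⟩)

/-- An egalitarian outcome minimizes the largest disutility. -/
theorem IsEgalOutcome.disutility_le {m n : ℕ} [NeZero n] {I : Profile m n} {x : Dist m}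
    (hx : IsEgalOutcome I x) (y : Dist m) {c : ℝ} (hy : ∀ i, disutility (I i) y ≤ c) (i : Fin n) :
    disutility (I i) x ≤ c :=
  (disutilityVector_zero_le_iff I x c).1
    ((apply_zero_le_of_toLex_le (hx y)).trans ((disutilityVector_zero_le_iff I y c).2 hy)) i

/-! #### Leximin comparisons through exponential sums -/

/-- At the first index where the vectors differ, `exp (K * b k)` eventually outweighs `n` copies of
`exp (K * a k)`. These dominate the remaining terms of `a`, because `a` is non-increasing. -/
theorem eventually_sum_exp_lt {n : ℕ} {a b : Fin n → ℝ} (ha : Antitone a)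
    (h : toLex a < toLex b) :
    ∀ᶠ K : ℝ in Filter.atTop, ∑ i, Real.exp (K * a i) < ∑ i, Real.exp (K * b i) := by
  obtain ⟨k, hk, hlt⟩ := h
  replace hk : ∀ j < k, a j = b j := hk
  replace hlt : a k < b k := hlt
  -- Beyond this threshold `n ≤ K * (b k - a k)`, and the exponential of the right side exceeds `n`.
  filter_upwards [Filter.eventually_ge_atTop (n / (b k - a k)), Filter.eventually_ge_atTop 0] with K hK hK0
  rw [div_le_iff₀ (by linarith)] at hK
  have hexp : n * Real.exp (K * a k) < Real.exp (K * b k) := by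
    have h1 : K * b k = K * (b k - a k) + K * a k := by ring
    rw [h1, Real.exp_add]
    exact mul_lt_mul_of_pos_right
      (by linarith [Real.add_one_le_exp (K * (b k - a k))]) (Real.exp_pos _)
  have hA : ∑ i, Real.exp (K * a i) ≤
      ∑ i, ((if i < k then Real.exp (K * b i) else 0) + Real.exp (K * a k)) := by
    refine Finset.sum_le_sum fun i _ => ?_
    split_ifs with hi
    · rw [hk i hi]
      linarith [Real.exp_pos (K * a k)]
    · rw [zero_add]
      exact Real.exp_le_exp.2 (mul_le_mul_of_nonneg_left (ha (not_lt.1 hi)) hK0)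
  have hB : ∑ i, ((if i < k then Real.exp (K * b i) else 0) +
      if i = k then Real.exp (K * b i) else 0) ≤ ∑ i, Real.exp (K * b i) := by
    refine Finset.sum_le_sum fun i _ => ?_
    have := Real.exp_pos (K * b i)
    split_ifs with h1 h2 h2
    · exact absurd h2 h1.ne
    all_goals linarith
  rw [Finset.sum_add_distrib] at hA hB
  simp only [Finset.sum_const, Finset.card_univ, Fintype.card_fin, nsmul_eq_mul,
    Finset.sum_ite_eq', Finset.mem_univ, if_true] at hA hB
  linarith

/-- The exponential sum of the disutilities; for large `K` it orders the outcomes like the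
leximin order. -/
def expDisutility {m n : ℕ} (I : Profile m n) (x : Dist m) (K : ℝ) : ℝ :=
  ∑ i, Real.exp (K * disutility (I i) x)

theorem sum_exp_disutilityVector {m n : ℕ} (I : Profile m n) (x : Dist m) (K : ℝ) :
    ∑ i, Real.exp (K * disutilityVector I x i) = expDisutility I x K :=
  Equiv.sum_comp (Fin.revPerm.trans (Tuple.sort fun i => disutility (I i) x))
    fun i => Real.exp (K * disutility (I i) x)

theorem antitone_disutilityVector {m n : ℕ} (I : Profile m n) (x : Dist m) :
    Antitone (disutilityVector I x) := fun _ _ h =>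
  Tuple.monotone_sort (fun i => disutility (I i) x) (Fin.rev_le_rev.2 h)

theorem eventually_expDisutility_lt {m n : ℕ} {I : Profile m n} {x y : Dist m}
    (h : toLex (disutilityVector I x) < toLex (disutilityVector I y)) :
    ∀ᶠ K in Filter.atTop, expDisutility I x K < expDisutility I y K := by
  simpa only [sum_exp_disutilityVector] using
    eventually_sum_exp_lt (antitone_disutilityVector I x) h

theorem eventually_expDisutility_le {m n : ℕ} {I : Profile m n} {x y : Dist m}
    (h : toLex (disutilityVector I x) ≤ toLex (disutilityVector I y)) :
    ∀ᶠ K in Filter.atTop, expDisutility I x K ≤ expDisutility I y K := by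
  rcases h.lt_or_eq with h | h
  · exact (eventually_expDisutility_lt h).mono fun _ => le_of_lt
  · refine Filter.Eventually.of_forall fun K => ?_
    rw [← sum_exp_disutilityVector, ← sum_exp_disutilityVector, toLex_inj.1 h]

theorem expDisutility_append {m n n' : ℕ} (I : Profile m n) (I' : Profile m n') (x : Dist m)
    (K : ℝ) :
    expDisutility (Fin.append I I') x K = expDisutility I x K + expDisutility I' x K := by
  simp only [expDisutility, Fin.sum_univ_add, Fin.append_left, Fin.append_right]

/-- Exponential sums add over electorates, so a strict leximin improvement for the union would be
one for a part, for large `K`. -/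
theorem IsEgalOutcome.append {m n n' : ℕ} {I : Profile m n} {I' : Profile m n'} {x : Dist m}
    (h : IsEgalOutcome I x) (h' : IsEgalOutcome I' x) : IsEgalOutcome (Fin.append I I') x := by
  intro y
  by_contra! hlt
  obtain ⟨K, h1, h2, h3⟩ := ((eventually_expDisutility_le (h y)).and
    ((eventually_expDisutility_le (h' y)).and (eventually_expDisutility_lt hlt))).exists
  rw [expDisutility_append, expDisutility_append] at h3
  linarith

theorem IsEgalOutcome.of_append {m n n' : ℕ} {I : Profile m n} {I' : Profile m n'} {x y : Dist m}
    (h : IsEgalOutcome I x) (h' : IsEgalOutcome I' x) (hy : IsEgalOutcome (Fin.append I I') y) :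
    IsEgalOutcome I y ∧ IsEgalOutcome I' y := by
  have hle := eventually_expDisutility_le (hy x)
  constructor
  · refine fun z => le_trans ?_ (h z)
    by_contra! hlt
    obtain ⟨K, h1, h2, h3⟩ := ((eventually_expDisutility_lt hlt).and
      ((eventually_expDisutility_le (h' y)).and hle)).exists
    rw [expDisutility_append, expDisutility_append] at h3
    linarith
  · refine fun z => le_trans ?_ (h' z)
    by_contra! hlt
    obtain ⟨K, h1, h2, h3⟩ := ((eventually_expDisutility_lt hlt).and
      ((eventually_expDisutility_le (h y)).and hle)).exists
    rw [expDisutility_append, expDisutility_append] at h3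
    linarith

theorem IsEgalOutcome.eq_of_single {m : ℕ} {I : Profile m 1} {x : Dist m}
    (h : IsEgalOutcome I x) : x = I 0 := by
  refine eq_of_disutility_le_zero (h.disutility_le (I 0) (fun i => ?_) 0)
  rw [Subsingleton.elim i 0]
  simp [disutility]

/-- The joint choice is Egal for both parts, and the common choice is Egal for the union. If they
differed, consistency between the union and one part would fail. For `n = 1` the Egal outcome is
unique, so consistency is not needed. -/
theorem reinforcementFor_of_isEgalRule {m : ℕ} {F : AggregationRule m} (hF : IsEgalRule F)
    {S : Set ℕ} (hc : ConsistentTieBreaking F S) (n n' : ℕ) [NeZero n] [NeZero n']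
    (hS : n = 1 ∨ (n ∈ S ∨ n' ∈ S) ∧ n + n' ∈ S) : ReinforcementFor F n n' := by
  have : NeZero (n + n') := ⟨by have := NeZero.pos n; omega⟩
  intro I I' h
  have hx := hF n I
  have hx' := hF n' I'
  rw [← h] at hx'
  have hy := hF (n + n') (Fin.append I I')
  have hxc := hx.append hx'
  obtain ⟨hyI, hyI'⟩ := hx.of_append hx' hy
  by_contra hne
  rcases hS with rfl | ⟨hn | hn, hs⟩
  · exact hne (hyI.eq_of_single.trans hx.eq_of_single.symm)
  · exact hc n (n + n') hn hs I (Fin.append I I') _ _ hx hyI hxc hy (Ne.symm hne) rfl rfl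
  · exact hc n' (n + n') hn hs I' (Fin.append I I') _ _ hx' hyI' hxc hy (Ne.symm hne) h.symm rfl

/-! #### Two candidates -/

theorem disutility_two (s x : Dist 2) (j : Fin 2) : disutility s x = 2 * |s j - x j| := by
  have h1 := s.sum_eq_one
  have h2 := x.sum_eq_one
  rw [Fin.sum_univ_two] at h1 h2
  have h : |s 1 - x 1| = |s 0 - x 0| := by
    rw [abs_sub_comm, show x 1 - s 1 = s 0 - x 0 by linarith]
  unfold disutility
  rw [Fin.sum_univ_two, h]
  fin_cases j <;> simp [h] <;> ring

/-- The distribution over two candidates that assigns `p` to candidate `j`. -/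
def distTwo (j : Fin 2) (p : ℝ) (h0 : 0 ≤ p) (h1 : p ≤ 1) : Dist 2 :=
  ⟨fun k => if k = j then p else 1 - p, by
    refine ⟨fun k => ?_, ?_⟩
    · dsimp only
      split_ifs <;> linarith
    · fin_cases j <;> simp⟩

/-- The midrange keeps all disutilities within the spread of the column. The agents with the lowest
and the highest score then leave no other value. -/
theorem IsEgalOutcome.apply_of_two {n : ℕ} [NeZero n] {I : Profile 2 n} {x : Dist 2}
    (hx : IsEgalOutcome I x) (j : Fin 2) :
    x j = (Finset.univ.inf' Finset.univ_nonempty (fun i => I i j) +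
      Finset.univ.sup' Finset.univ_nonempty fun i => I i j) / 2 := by
  obtain ⟨a, -, ha⟩ := Finset.exists_mem_eq_inf' Finset.univ_nonempty fun i => I i j
  obtain ⟨b, -, hb⟩ := Finset.exists_mem_eq_sup' Finset.univ_nonempty fun i => I i j
  have hlo : ∀ i, I a j ≤ I i j := fun i =>
    ha.symm.trans_le (Finset.inf'_le (fun i => I i j) (Finset.mem_univ i))
  have hhi : ∀ i, I i j ≤ I b j := fun i =>
    (Finset.le_sup' (fun i => I i j) (Finset.mem_univ i)).trans_eq hb
  rw [ha, hb]
  have ha0 := (I a).nonneg j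
  have hb0 := (I b).nonneg j
  have ha1 := (I a).le_one j
  have hb1 := (I b).le_one j
  have hy := hx.disutility_le (distTwo j ((I a j + I b j) / 2) (by linarith) (by linarith))
    (c := I b j - I a j) fun i => by
      have h1 := hlo i
      have h2 := hhi i
      have h3 : distTwo j ((I a j + I b j) / 2) (by linarith) (by linarith) j =
        (I a j + I b j) / 2 := if_pos rfl
      rw [disutility_two _ _ j, h3]
      have : |I i j - (I a j + I b j) / 2| ≤ (I b j - I a j) / 2 :=
        abs_le.2 ⟨by linarith, by linarith⟩
      linarith
  have h1 := hy a
  have h2 := hy b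
  rw [disutility_two _ _ j] at h1 h2
  have h3 := neg_le_abs (I a j - x j)
  have h4 := le_abs_self (I b j - x j)
  linarith

theorem scoreMonotone_egal_two {F : AggregationRule 2} (hF : IsEgalRule F) (n : ℕ) [NeZero n] :
    ScoreMonotone F n := by
  rintro I I' j ⟨i, hl, hj, -⟩
  rw [(hF n I).apply_of_two j, (hF n I').apply_of_two j]
  have h := score_le_of_change hl hj
  refine div_le_div_of_nonneg_right (add_le_add ?_ ?_) zero_le_two
  · exact Finset.le_inf' _ _ fun l hm => (Finset.inf'_le _ hm).trans (h l)
  · exact Finset.sup'_le _ _ fun l hm => (h l).trans (Finset.le_sup' (fun l => I' l j) hm)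

theorem independence_of_agreesWithAvgOnPairs {m : ℕ} [NeZero m] {F : AggregationRule m}
    (h : AgreesWithAvgOnPairs F) : Independence F 2 := fun I I' j hj => by
  rw [h I, h I']
  exact independence_avgRule m 2 I I' j hj

theorem scoreMonotone_of_agreesWithAvgOnPairs {m : ℕ} [NeZero m] {F : AggregationRule m}
    (h : AgreesWithAvgOnPairs F) : ScoreMonotone F 2 := fun I I' j hj => by
  rw [h I, h I']
  exact scoreMonotone_avgRule m 2 I I' j hj

/-! ### Instances for the negative results -/

/-- All weight on candidate `j`. -/
def pureDist {m : ℕ} (j : Fin m) : Dist m := ⟨Pi.single j 1, single_mem_stdSimplex ℝ j⟩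

theorem pureDist_apply {m : ℕ} (j k : Fin m) : pureDist j k = if k = j then 1 else 0 :=
  Pi.single_apply j (1 : ℝ) k

theorem disutility_pureDist {m : ℕ} (j : Fin m) (x : Dist m) :
    disutility (pureDist j) x = 2 * (1 - x j) := by
  have h1 : |pureDist j j - x j| + ∑ k ∈ Finset.univ.erase j, |pureDist j k - x k| =
    disutility (pureDist j) x :=
      Finset.add_sum_erase Finset.univ (fun k => |pureDist j k - x k|) (Finset.mem_univ j)
  have h2 : x j + ∑ k ∈ Finset.univ.erase j, x k = ∑ k, x k :=
    Finset.add_sum_erase Finset.univ (fun k => x k) (Finset.mem_univ j)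
  have h3 : ∑ k ∈ Finset.univ.erase j, |pureDist j k - x k| = ∑ k ∈ Finset.univ.erase j, x k :=
    Finset.sum_congr rfl fun k hk => by
      rw [pureDist_apply, if_neg (Finset.ne_of_mem_erase hk), zero_sub, abs_neg,
        abs_of_nonneg (x.nonneg k)]
  rw [h3, pureDist_apply, if_pos rfl, abs_of_nonneg (sub_nonneg.2 (x.le_one j))] at h1
  rw [x.sum_eq_one] at h2
  linarith

variable {k r n : ℕ}

/-- Extend a distribution over `k` candidates by `r` candidates of weight zero. -/
def padDist (f : Fin k → ℝ) (h0 : ∀ j, 0 ≤ f j) (h1 : ∑ j, f j = 1) : Dist (k + r) :=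
  ⟨Fin.append f 0, by
    refine ⟨fun j => ?_, ?_⟩
    · refine Fin.addCases (fun i => ?_) (fun i => ?_) j
      · rw [Fin.append_left]; exact h0 i
      · rw [Fin.append_right]; rfl
    · simp [Fin.sum_univ_add, h1]⟩

theorem padDist_castAdd (f : Fin k → ℝ) (h0 : ∀ j, 0 ≤ f j) (h1 : ∑ j, f j = 1) (j : Fin k) :
    (padDist f h0 h1 : Dist (k + r)) (Fin.castAdd r j) = f j := Fin.append_left f 0 j

theorem padDist_natAdd (f : Fin k → ℝ) (h0 : ∀ j, 0 ≤ f j) (h1 : ∑ j, f j = 1) (j : Fin r) :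
    (padDist f h0 h1 : Dist (k + r)) (Fin.natAdd k j) = 0 := Fin.append_right f 0 j

/-- The padding candidates contribute exactly the weight that `x` places outside the first `k`. -/
theorem disutility_padDist (f : Fin k → ℝ) (h0 : ∀ j, 0 ≤ f j) (h1 : ∑ j, f j = 1)
    (x : Dist (k + r)) :
    disutility (padDist f h0 h1) x =
      (∑ j, |f j - x (Fin.castAdd r j)|) + (1 - ∑ j, x (Fin.castAdd r j)) := by
  have h := x.sum_eq_one
  rw [Fin.sum_univ_add] at h
  unfold disutility
  simp only [Fin.sum_univ_add, padDist_castAdd, padDist_natAdd, zero_sub, abs_neg,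
    abs_of_nonneg (x.nonneg _)]
  linarith

theorem sum_castAdd_le_one (x : Dist (k + r)) : ∑ j, x (Fin.castAdd r j) ≤ 1 := by
  have h := x.sum_eq_one
  rw [Fin.sum_univ_add] at h
  linarith [Finset.sum_nonneg fun j (_ : j ∈ Finset.univ) => x.nonneg (Fin.natAdd k j : Fin (k + r))]

/-! #### Coordinate-wise rules -/

/-- The profile whose first three columns are `a`, `b` and `c`. -/
def tripleProfile (a b c : Fin n → ℝ) (ha : ∀ i, 0 ≤ a i) (hb : ∀ i, 0 ≤ b i) (hc : ∀ i, 0 ≤ c i)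
    (hs : ∀ i, a i + b i + c i = 1) : Profile (3 + r) n := fun i =>
  padDist ![a i, b i, c i] (by simp [Fin.forall_fin_succ, ha, hb, hc])
    (by simp [Fin.sum_univ_three, hs])

theorem coordRule_eq_of_eq_mul {m : ℕ} [NeZero m] [NeZero n]
    (f : ∀ (n : ℕ) [NeZero n], (Fin n → ℝ) → ℝ)
    (hf : ∀ (n : ℕ) [NeZero n] (v : Fin n → ℝ), (∀ i, 0 ≤ v i) → 0 ≤ f n v) (I : Profile m n)
    (x : Dist m) {c : ℝ} (hc : c ≠ 0) (h : ∀ j, f n (fun i => I i j) = c * x j) :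
    coordRule f hf n I = x :=
  normalize_of_eq_mul _ (fun j => hf n _ fun i => (I i).2.1 j) x hc h

theorem coordRule_tripleProfile [NeZero (3 + r)] [NeZero n]
    (f : ∀ (n : ℕ) [NeZero n], (Fin n → ℝ) → ℝ)
    (hf : ∀ (n : ℕ) [NeZero n] (v : Fin n → ℝ), (∀ i, 0 ≤ v i) → 0 ≤ f n v)
    (a b c : Fin n → ℝ) (ha : ∀ i, 0 ≤ a i) (hb : ∀ i, 0 ≤ b i) (hc : ∀ i, 0 ≤ c i)
    (hs : ∀ i, a i + b i + c i = 1) (h0 : f n (fun _ => 0) = 0) :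
    f n a = (f n a + f n b + f n c) *
      coordRule f hf n (tripleProfile a b c ha hb hc hs) (Fin.castAdd r 0) := by
  have h := eq_sum_mul_normalize
    (fun j => f n fun i => (tripleProfile a b c ha hb hc hs : Profile (3 + r) n) i j)
    (fun j => hf n _ fun i => Dist.nonneg _ j) (Fin.castAdd r 0)
  rw [Fin.sum_univ_add, Fin.sum_univ_three] at h
  simp only [tripleProfile, padDist_castAdd, padDist_natAdd, h0, Finset.sum_const_zero,
    add_zero] at h
  exact h

/-- The first column and its aggregate stay fixed while the normalizing sum changes, so its
normalized score changes. -/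
theorem not_independence_coordRule [NeZero (3 + r)] [NeZero n]
    (f : ∀ (n : ℕ) [NeZero n], (Fin n → ℝ) → ℝ)
    (hf : ∀ (n : ℕ) [NeZero n] (v : Fin n → ℝ), (∀ i, 0 ≤ v i) → 0 ≤ f n v)
    (a b c b' c' : Fin n → ℝ) (ha : ∀ i, 0 ≤ a i) (hb : ∀ i, 0 ≤ b i) (hc : ∀ i, 0 ≤ c i)
    (hb' : ∀ i, 0 ≤ b' i) (hc' : ∀ i, 0 ≤ c' i)
    (hs : ∀ i, a i + b i + c i = 1) (hs' : ∀ i, a i + b' i + c' i = 1)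
    (h0 : f n (fun _ => 0) = 0) (hpos : 0 < f n a) (hne : f n b + f n c ≠ f n b' + f n c') :
    ¬ Independence (coordRule f hf : AggregationRule (3 + r)) n := by
  intro hI
  have e := coordRule_tripleProfile (r := r) f hf a b c ha hb hc hs h0
  have e' := coordRule_tripleProfile (r := r) f hf a b' c' ha hb' hc' hs' h0
  rw [hI (tripleProfile a b c ha hb hc hs) (tripleProfile a b' c' ha hb' hc' hs')
    (Fin.castAdd r 0) fun i => by simp [tripleProfile, padDist_castAdd]] at e
  have hx := left_ne_zero_of_mul (e ▸ hpos.ne')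
  have hy := right_ne_zero_of_mul (e' ▸ hpos.ne')
  have := mul_right_cancel₀ hy (e.symm.trans e')
  exact hne (by linarith)

/-- The second column, constantly `1 / 2`, is split between the second and third candidates: agent
`0` against the rest. Max then gains in total, while Min and Geo lose. -/
theorem not_independence_coordRule_of_half [NeZero (3 + r)] [NeZero n]
    (f : ∀ (n : ℕ) [NeZero n], (Fin n → ℝ) → ℝ)
    (hf : ∀ (n : ℕ) [NeZero n] (v : Fin n → ℝ), (∀ i, 0 ≤ v i) → 0 ≤ f n v)
    (h0 : f n (fun _ => 0) = 0) (hpos : 0 < f n fun _ => 1 / 2)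
    (hne : (f n fun _ => 1 / 2) ≠
      (f n fun i => if i = 0 then 1 / 2 else 0) + f n fun i => if i = 0 then 0 else 1 / 2) :
    ¬ Independence (coordRule f hf : AggregationRule (3 + r)) n := by
  refine not_independence_coordRule f hf (fun _ => 1 / 2) (fun _ => 1 / 2) (fun _ => 0)
    (fun i => if i = 0 then 1 / 2 else 0) (fun i => if i = 0 then 0 else 1 / 2)
    ?_ ?_ ?_ ?_ ?_ ?_ ?_ h0 hpos (by rwa [h0, add_zero])
  all_goals intro i; try split_ifs
  all_goals norm_num

theorem not_independence_maxRule [NeZero (3 + r)] [NeZero n] (hn : 2 ≤ n) :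
    ¬ Independence (maxRule (3 + r)) n := by
  refine not_independence_coordRule_of_half _ _ ?_ ?_ (ne_of_lt ?_)
  · simp
  · simp
  · have h1 := Finset.le_sup' (fun i : Fin n => if i = 0 then (1 / 2 : ℝ) else 0)
      (Finset.mem_univ 0)
    have h2 := Finset.le_sup' (fun i : Fin n => if i = 0 then (0 : ℝ) else 1 / 2)
      (Finset.mem_univ ⟨1, hn⟩)
    have h3 : (⟨1, hn⟩ : Fin n) ≠ 0 := by simp [Fin.ext_iff]
    simp only [if_true, h3, if_false] at h1 h2
    rw [Finset.sup'_const]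
    linarith

theorem not_independence_minRule [NeZero (3 + r)] [NeZero n] (hn : 2 ≤ n) :
    ¬ Independence (minRule (3 + r)) n := by
  refine not_independence_coordRule_of_half _ _ ?_ ?_ (ne_of_gt ?_)
  · simp
  · simp
  · have h1 := Finset.inf'_le (fun i : Fin n => if i = 0 then (1 / 2 : ℝ) else 0)
      (Finset.mem_univ ⟨1, hn⟩)
    have h2 := Finset.inf'_le (fun i : Fin n => if i = 0 then (0 : ℝ) else 1 / 2)
      (Finset.mem_univ 0)
    have h3 : (⟨1, hn⟩ : Fin n) ≠ 0 := by simp [Fin.ext_iff]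
    simp only [if_true, h3, if_false] at h1 h2
    rw [Finset.inf'_const]
    linarith

theorem not_independence_geoRule [NeZero (3 + r)] [NeZero n] (hn : 2 ≤ n) :
    ¬ Independence (geoRule (3 + r)) n := by
  have hn0 : (1 / (n : ℝ)) ≠ 0 := by
    have := NeZero.ne n
    positivity
  have hpos : 0 < (∏ _i : Fin n, (1 / 2 : ℝ)) ^ (1 / (n : ℝ)) := by positivity
  refine not_independence_coordRule_of_half _ _ ?_ hpos (ne_of_gt ?_)
  · rw [Finset.prod_eq_zero (Finset.mem_univ 0) rfl, Real.zero_rpow hn0]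
  · have h3 : (⟨1, hn⟩ : Fin n) ≠ 0 := by simp [Fin.ext_iff]
    have h1 : ∏ i : Fin n, (if i = 0 then (1 / 2 : ℝ) else 0) = 0 :=
      Finset.prod_eq_zero (Finset.mem_univ ⟨1, hn⟩) (if_neg h3)
    have h2 : ∏ i : Fin n, (if i = 0 then (0 : ℝ) else 1 / 2) = 0 :=
      Finset.prod_eq_zero (Finset.mem_univ 0) (if_pos rfl)
    rw [h1, h2, Real.zero_rpow hn0, add_zero]
    exact hpos

/-- A constant second column would not do for even `n`: splitting it into halves gives two medians
`1 / 4` and leaves the sum unchanged. Agent `0` therefore supports the first candidate only. The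
second column still has median `1 / 2`, but splitting it leaves at most half of the entries positive
in one part and fewer than half in the other. -/
theorem not_independence_medRule [NeZero (3 + r)] [NeZero n] (hn : 3 ≤ n) :
    ¬ Independence (medRule (3 + r)) n := by
  obtain ⟨b', hb'⟩ : ∃ b' : Fin n → ℝ, b' = fun i : Fin n =>
    if i = 0 then (0 : ℝ) else if (i : ℕ) ≤ n / 2 then 1 / 2 else 0 := ⟨_, rfl⟩
  obtain ⟨c', hc'⟩ : ∃ c' : Fin n → ℝ, c' = fun i : Fin n =>
    if i = 0 then (0 : ℝ) else if (i : ℕ) ≤ n / 2 then 0 else 1 / 2 := ⟨_, rfl⟩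
  have hlt : n / 2 < n := by omega
  refine not_independence_coordRule _ _ (fun i => if i = 0 then 1 else 1 / 2)
    (fun i => if i = 0 then 0 else 1 / 2) (fun _ => 0) b' c' (fun i => ?_) (fun i => ?_)
    (fun _ => le_rfl) (fun i => ?_) (fun i => ?_) (fun i => ?_) (fun i => ?_)
    (median_const 0) ?_ (ne_of_gt ?_)
  · split_ifs <;> norm_num
  · split_ifs <;> norm_num
  · simp only [hb']
    split_ifs <;> norm_num
  · simp only [hc']
    split_ifs <;> norm_num
  · split_ifs <;> norm_num
  · simp only [hb', hc']
    split_ifs <;> norm_num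
  · refine lt_of_lt_of_le (b := median fun _ : Fin n => (1 / 2 : ℝ)) ?_ (median_mono fun i => ?_)
    · rw [median_const]; norm_num
    · split_ifs <;> norm_num
  · rw [median_const, add_zero]
    have hb : median (fun i : Fin n => if i = 0 then (0 : ℝ) else 1 / 2) = 1 / 2 := by
      refine median_eq_of_lt ?_ ?_
      · rw [Finset.filter_true_of_mem fun i _ => by split_ifs <;> norm_num, Finset.card_univ,
          Fintype.card_fin]
        omega
      · have hsub : Finset.univ.erase (0 : Fin n) ⊆
            Finset.univ.filter fun i => (1 / 2 : ℝ) ≤ if i = 0 then 0 else 1 / 2 := fun i hi => by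
          simp [Finset.ne_of_mem_erase hi]
        have := Finset.card_le_card hsub
        rw [Finset.card_erase_of_mem (Finset.mem_univ _), Finset.card_univ, Fintype.card_fin] at this
        omega
    have hc0 : upperMedian c' ≤ 0 := by
      rw [upperMedian_le_iff]
      have hsub : Finset.Iic (⟨n / 2, hlt⟩ : Fin n) ⊆ Finset.univ.filter fun i => c' i ≤ 0 := by
        intro i hi
        rw [Finset.mem_Iic, Fin.le_def] at hi
        simp only at hi
        simp [hc', hi]
      have := Finset.card_le_card hsub
      rw [Fin.card_Iic] at this
      simp only at this
      omega
    have hb0 : lowerMedian b' ≤ 0 := by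
      rw [lowerMedian_le_iff]
      have hsub : (Finset.univ.filter fun i => 0 < b' i) ⊆
          Finset.Ioc (0 : Fin n) ⟨n / 2, hlt⟩ := by
        intro i hi
        simp only [hb', Finset.mem_filter, Finset.mem_univ, true_and] at hi
        rw [Finset.mem_Ioc]
        split_ifs at hi with h1 h2
        · exact absurd hi (lt_irrefl _)
        · exact ⟨Fin.pos_iff_ne_zero.2 h1, h2⟩
        · exact absurd hi (lt_irrefl _)
      have h1 := Finset.card_le_card hsub
      have h2 := card_le_eq_sub b' 0
      rw [Fin.card_Ioc] at h1
      simp only [Fin.val_zero] at h1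
      omega
    have hb1 : upperMedian b' ≤ 1 / 2 := by
      rw [upperMedian_le_iff, Finset.filter_true_of_mem fun i _ => by
        simp only [hb']; split_ifs <;> norm_num, Finset.card_univ, Fintype.card_fin]
      omega
    have hc1 := lowerMedian_le_upperMedian c'
    rw [hb, median_eq, median_eq]
    linarith

/-- The medians are `1 / 2` in each of the first three columns of `I` and `1 / 3` in those of `I'`,
so both outcomes are uniform there, at different scales. In the union the first column has median `1
/ 2` and the second `1 / 3`. -/
theorem not_reinforcementFor_medRule [NeZero (3 + r)] :
    ¬ ReinforcementFor (medRule (3 + r)) 3 2 := by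
  intro h
  let A : Fin 3 → Fin 3 → ℝ := ![![1 / 2, 1 / 2, 0], ![1 / 2, 0, 1 / 2], ![0, 1 / 2, 1 / 2]]
  let B : Fin 2 → Fin 3 → ℝ := ![![2 / 3, 1 / 3, 0], ![0, 1 / 3, 2 / 3]]
  let I : Profile (3 + r) 3 := fun i => padDist (A i)
    (by fin_cases i <;> simp [A, Fin.forall_fin_succ])
    (by fin_cases i <;> simp [A, Fin.sum_univ_three] <;> norm_num)
  let I' : Profile (3 + r) 2 := fun i => padDist (B i)
    (by fin_cases i <;> simp [B, Fin.forall_fin_succ] <;> norm_num)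
    (by fin_cases i <;> simp [B, Fin.sum_univ_three] <;> norm_num)
  let x : Dist (3 + r) := padDist (fun _ => 1 / 3) (fun _ => by norm_num) (by simp)
  have hI : medRule (3 + r) 3 I = x := by
    refine coordRule_eq_of_eq_mul _ _ _ x (c := 3 / 2) (by norm_num) fun j => ?_
    refine Fin.addCases (fun j => ?_) (fun j => ?_) j
    · simp only [I, x, padDist_castAdd]
      refine (median_eq_of_lt (a := 1 / 2) ?_ ?_).trans (by norm_num) <;>
        fin_cases j <;> simp [A, Finset.card_filter, -Finset.sum_boole, Fin.sum_univ_succ] <;> norm_num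
    · simp only [I, x, padDist_natAdd, median_const, mul_zero]
  have hI' : medRule (3 + r) 2 I' = x := by
    refine coordRule_eq_of_eq_mul _ _ _ x (c := 1) one_ne_zero fun j => ?_
    refine Fin.addCases (fun j => ?_) (fun j => ?_) j
    · simp only [I', x, padDist_castAdd, median_pair]
      fin_cases j <;> simp [B, Fin.sum_univ_two] <;> norm_num
    · simp only [I', x, padDist_natAdd, median_const, mul_zero]
  have hx := (h I I' (hI.trans hI'.symm)).trans hI
  have hm : ∀ j, median (fun l => Fin.append I I' l j) = _ * medRule (3 + r) 5 (Fin.append I I') j :=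
    eq_sum_mul_normalize (fun j => median fun l => Fin.append I I' l j)
      fun j => median_nonneg _ fun l => Dist.nonneg _ j
  have hx' : medRule (3 + r) 5 (Fin.append I I') = x := hx
  have h0 : median (fun l => Fin.append I I' l (Fin.castAdd r 0)) = 1 / 2 := by
    rw [append_apply_candidate]
    simp only [I, I', padDist_castAdd]
    refine median_eq_of_lt ?_ ?_ <;>
      simp only [Finset.card_filter, Fin.sum_univ_add, Fin.append_left, Fin.append_right] <;>
      simp [A, B, -Finset.sum_boole, Fin.sum_univ_succ] <;> norm_num
  have h1 : median (fun l => Fin.append I I' l (Fin.castAdd r 1)) = 1 / 3 := by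
    rw [append_apply_candidate]
    simp only [I, I', padDist_castAdd]
    refine median_eq_of_lt ?_ ?_ <;>
      simp only [Finset.card_filter, Fin.sum_univ_add, Fin.append_left, Fin.append_right] <;>
      simp [A, B, -Finset.sum_boole, Fin.sum_univ_succ] <;> norm_num
  have e0 := hm (Fin.castAdd r 0)
  have e1 := hm (Fin.castAdd r 1)
  rw [hx', h0] at e0
  rw [hx', h1] at e1
  simp only [x, padDist_castAdd] at e0 e1
  linarith

/-! #### Egalitarian rules -/

/-- Three single-minded groups force `1 / 3` for the first candidate. Merging the second and third
group keeps the first column, but then agent `0` secures at least `1 / 2`. -/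
theorem not_independence_egal {F : AggregationRule (3 + r)} (hF : IsEgalRule F) [NeZero n]
    (hn : 3 ≤ n) : ¬ Independence F n := by
  intro hI
  let I : Profile (3 + r) n := fun i => if (i : ℕ) = 0 then pureDist (Fin.castAdd r 0) else
    if (i : ℕ) = 1 then pureDist (Fin.castAdd r 1) else pureDist (Fin.castAdd r 2)
  let I' : Profile (3 + r) n := fun i => if (i : ℕ) = 0 then pureDist (Fin.castAdd r 0) else
    pureDist (Fin.castAdd r 1)
  have hx := (hF n I).disutility_le (padDist ![1 / 3, 1 / 3, 1 / 3]
    (by simp [Fin.forall_fin_succ]) (by simp [Fin.sum_univ_three]; norm_num)) (c := 4 / 3)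
    fun i => by
      simp only [I]
      split_ifs <;> simp only [disutility_pureDist, padDist_castAdd] <;> simp <;> norm_num
  have hy := (hF n I').disutility_le (padDist ![1 / 2, 1 / 2, 0]
    (by simp [Fin.forall_fin_succ]) (by simp [Fin.sum_univ_three]; norm_num)) (c := 1)
    fun i => by
      simp only [I']
      split_ifs <;> simp only [disutility_pureDist, padDist_castAdd] <;> simp <;> norm_num
  have h := hI I I' (Fin.castAdd r 0) fun i => by
    simp only [I, I']
    split_ifs <;> simp [pureDist_apply]
  have hs := sum_castAdd_le_one (F n I)
  rw [Fin.sum_univ_three] at hs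
  have x0 := hx ⟨0, by omega⟩
  have x1 := hx ⟨1, by omega⟩
  have x2 := hx ⟨2, by omega⟩
  have y0 := hy ⟨0, by omega⟩
  generalize F n I = x at *
  generalize F n I' = y at *
  simp [I, disutility_pureDist] at x0 x1 x2
  simp [I', disutility_pureDist] at y0
  linarith

/-- The distribution over `4 + r` candidates with the given scores, in units of `1 / 40`, for the
first four candidates. -/
def quadDist (a b c d : ℕ) (h : a + b + c + d = 40) : Dist (4 + r) :=
  padDist ![a / 40, b / 40, c / 40, d / 40]
    (by
      simp only [Fin.forall_fin_succ]
      simp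
      refine ⟨?_, ?_, ?_, ?_⟩ <;> positivity)
    (by
      have : (a : ℝ) + b + c + d = 40 := by exact_mod_cast h
      simp only [Fin.sum_univ_four]
      simp
      linarith)

theorem disutility_quadDist (a b c d : ℕ) (h : a + b + c + d = 40) (x : Dist (4 + r)) :
    disutility (quadDist a b c d h) x =
      |(a : ℝ) / 40 - x (Fin.castAdd r 0)| + |(b : ℝ) / 40 - x (Fin.castAdd r 1)| +
      |(c : ℝ) / 40 - x (Fin.castAdd r 2)| + |(d : ℝ) / 40 - x (Fin.castAdd r 3)| +
      (1 - (x (Fin.castAdd r 0) + x (Fin.castAdd r 1) + x (Fin.castAdd r 2) +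
        x (Fin.castAdd r 3))) := by
  rw [quadDist, disutility_padDist, Fin.sum_univ_four, Fin.sum_univ_four]
  rfl

theorem quadDist_castAdd (a b c d : ℕ) (h : a + b + c + d = 40) :
    (quadDist a b c d h : Dist (4 + r)) (Fin.castAdd r 0) = a / 40 ∧
    (quadDist a b c d h : Dist (4 + r)) (Fin.castAdd r 1) = b / 40 ∧
    (quadDist a b c d h : Dist (4 + r)) (Fin.castAdd r 2) = c / 40 ∧
    (quadDist a b c d h : Dist (4 + r)) (Fin.castAdd r 3) = d / 40 :=
  ⟨padDist_castAdd _ _ _ 0, padDist_castAdd _ _ _ 1, padDist_castAdd _ _ _ 2,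
    padDist_castAdd _ _ _ 3⟩

/-- Agent `0` has scores `s`; the other agents have fixed scores. -/
def quadProfile (s : Dist (4 + r)) : Profile (4 + r) n := fun i =>
  if (i : ℕ) = 0 then s else if (i : ℕ) = 1 then quadDist 7 13 13 7 rfl else
    if (i : ℕ) = 2 then quadDist 13 7 13 7 rfl else quadDist 9 9 6 16 rfl

theorem quadProfile_disutility_le {s x : Dist (4 + r)} {c : ℝ} (h0 : disutility s x ≤ c)
    (h1 : disutility (quadDist 7 13 13 7 rfl) x ≤ c)
    (h2 : disutility (quadDist 13 7 13 7 rfl) x ≤ c)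
    (h3 : disutility (quadDist 9 9 6 16 rfl) x ≤ c) (i : Fin n) :
    disutility (quadProfile s i) x ≤ c := by
  unfold quadProfile
  split_ifs <;> assumption

/-- Agent `0` moves weight from the third to the fourth candidate. In units of `1 / 40`, the witness
`(10, 10, 10, 10)` bounds the old disutilities by `12` and `(12, 12, 7, 9)` bounds the new ones by
`14`. These bounds alone force the fourth score to be at least `10` before and at most `9` after. -/
theorem not_scoreMonotone_egal {F : AggregationRule (4 + r)} (hF : IsEgalRule F) [NeZero n]
    (hn : 4 ≤ n) : ¬ ScoreMonotone F n := by
  intro hM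
  let s : Dist (4 + r) := quadDist 12 12 4 12 rfl
  let s' : Dist (4 + r) := quadDist 12 12 0 16 rfl
  have hx := (hF n (quadProfile s)).disutility_le (quadDist 10 10 10 10 rfl) (c := 12 / 40) <| by
    obtain ⟨e0, e1, e2, e3⟩ := quadDist_castAdd (r := r) 10 10 10 10 rfl
    apply quadProfile_disutility_le <;> rw [disutility_quadDist, e0, e1, e2, e3] <;>
      norm_num [abs_of_pos, abs_of_neg]
  have hy := (hF n (quadProfile s')).disutility_le (quadDist 12 12 7 9 rfl) (c := 14 / 40) <| by
    obtain ⟨e0, e1, e2, e3⟩ := quadDist_castAdd (r := r) 12 12 7 9 rfl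
    apply quadProfile_disutility_le <;> rw [disutility_quadDist, e0, e1, e2, e3] <;>
      norm_num [abs_of_pos, abs_of_neg]
  have h := hM (quadProfile s) (quadProfile s') (Fin.castAdd r 3) ⟨⟨0, by omega⟩, ?_, ?_, ?_⟩
  · have x0 := hx ⟨0, by omega⟩
    have x1 := hx ⟨1, by omega⟩
    have x2 := hx ⟨2, by omega⟩
    have x3 := hx ⟨3, by omega⟩
    have y0 := hy ⟨0, by omega⟩
    have y1 := hy ⟨1, by omega⟩
    have y2 := hy ⟨2, by omega⟩
    have y3 := hy ⟨3, by omega⟩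
    have hsx := sum_castAdd_le_one (F n (quadProfile s))
    have hsy := sum_castAdd_le_one (F n (quadProfile s'))
    rw [Fin.sum_univ_four] at hsx hsy
    generalize F n (quadProfile s) = x at *
    generalize F n (quadProfile s') = y at *
    simp only [quadProfile, s, s', if_true, if_false, OfNat.ofNat_ne_zero, one_ne_zero,
      OfNat.ofNat_ne_one, Nat.reduceEqDiff, disutility_quadDist]
      at x0 x1 x2 x3 y0 y1 y2 y3
    push_cast at x0 x1 x2 x3 y0 y1 y2 y3
    have lower : ∀ a z : ℝ, a - z ≤ |a - z| := fun a z => le_abs_self _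
    have upper : ∀ a z : ℝ, z - a ≤ |a - z| := fun a z => by
      rw [abs_sub_comm]; exact le_abs_self _
    have l0 := lower (12 / 40) (x (Fin.castAdd r 0))
    have l1 := lower (12 / 40) (x (Fin.castAdd r 1))
    have l2 := upper (4 / 40) (x (Fin.castAdd r 2))
    have l3 := lower (12 / 40) (x (Fin.castAdd r 3))
    have b0 := upper (7 / 40) (x (Fin.castAdd r 0))
    have b1 := lower (13 / 40) (x (Fin.castAdd r 1))
    have b2 := lower (13 / 40) (x (Fin.castAdd r 2))
    have b3 := upper (7 / 40) (x (Fin.castAdd r 3))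
    have c0 := lower (13 / 40) (x (Fin.castAdd r 0))
    have c1 := upper (7 / 40) (x (Fin.castAdd r 1))
    have c2 := lower (13 / 40) (x (Fin.castAdd r 2))
    have c3 := upper (7 / 40) (x (Fin.castAdd r 3))
    have d0 := upper (9 / 40) (x (Fin.castAdd r 0))
    have d1 := upper (9 / 40) (x (Fin.castAdd r 1))
    have d2 := upper (6 / 40) (x (Fin.castAdd r 2))
    have d3 := lower (16 / 40) (x (Fin.castAdd r 3))
    -- Agent `3` suffices: the shortfall `16 / 40 - x 3` is at most half of its disutility.
    have hx3 : 10 / 40 ≤ x (Fin.castAdd r 3) := by linarith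
    clear x0 x1 x2 x3 l0 l1 l2 l3 b0 b1 b2 b3 c0 c1 c2 c3 d0 d1 d2 d3
    have l0 := lower (12 / 40) (y (Fin.castAdd r 0))
    have l1 := lower (12 / 40) (y (Fin.castAdd r 1))
    have l2 := upper (0 / 40) (y (Fin.castAdd r 2))
    have l3 := lower (16 / 40) (y (Fin.castAdd r 3))
    have b0 := upper (7 / 40) (y (Fin.castAdd r 0))
    have b1 := lower (13 / 40) (y (Fin.castAdd r 1))
    have b2 := lower (13 / 40) (y (Fin.castAdd r 2))
    have b3 := upper (7 / 40) (y (Fin.castAdd r 3))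
    have c0 := lower (13 / 40) (y (Fin.castAdd r 0))
    have c1 := upper (7 / 40) (y (Fin.castAdd r 1))
    have c2 := lower (13 / 40) (y (Fin.castAdd r 2))
    have c3 := upper (7 / 40) (y (Fin.castAdd r 3))
    have d0 := upper (9 / 40) (y (Fin.castAdd r 0))
    have d1 := upper (9 / 40) (y (Fin.castAdd r 1))
    have d2 := upper (6 / 40) (y (Fin.castAdd r 2))
    have d3 := lower (16 / 40) (y (Fin.castAdd r 3))
    -- In units of `1 / 40`, agent `0` gives `y 2 ≤ 7`, and agents `1` and `2` give `y 1 + y 2 ≥ 19`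
    -- and `y 0 + y 2 ≥ 19`. As the total is at most `40`, `y 3 ≤ 40 - 38 + 7`.
    have hy3 : y (Fin.castAdd r 3) ≤ 9 / 40 := by linarith
    linarith
  · intro l hl
    have : (l : ℕ) ≠ 0 := fun h => hl (Fin.ext h)
    simp [quadProfile, this]
  · simp only [quadProfile, if_true, s, s']
    rw [(quadDist_castAdd _ _ _ _ _).2.2.2, (quadDist_castAdd _ _ _ _ _).2.2.2]
    norm_num
  · intro k hk
    simp only [quadProfile, if_true, s, s']
    induction k using Fin.addCases with
    | left j =>
      simp only [quadDist, padDist_castAdd]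
      fin_cases j <;> simp at hk ⊢
      norm_num
    | right j => simp only [quadDist, padDist_natAdd, le_refl]

/-! #### The utilitarian rule -/

theorem distUniform_eq {m : ℕ} [NeZero m] (x : Dist m) :
    distUniform x = ∑ j, x j ^ 2 - 1 / (m : ℝ) := by
  have hm : (m : ℝ) ≠ 0 := Nat.cast_ne_zero.2 (NeZero.ne m)
  have h : ∀ j, (x j - 1 / (m : ℝ)) ^ 2 = x j ^ 2 - 2 / m * x j + 1 / m ^ 2 := fun j => by ring
  simp only [distUniform, h, Finset.sum_add_distrib, Finset.sum_sub_distrib, ← Finset.mul_sum,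
    x.sum_eq_one, Finset.sum_const, Finset.card_univ, Fintype.card_fin, nsmul_eq_mul]
  field_simp
  ring

theorem IsUtilOutcome.sum_sq_le {m : ℕ} [NeZero m] {I : Profile m n} {x : Dist m}
    (hx : IsUtilOutcome I x) (y : Dist m) (hy : ∀ z, utilWelfare I z ≤ utilWelfare I y) :
    ∑ j, x j ^ 2 ≤ ∑ j, y j ^ 2 := by
  have := hx.2 y hy
  rw [distUniform_eq, distUniform_eq] at this
  linarith

theorem sum_sq_padDist (f : Fin k → ℝ) (h0 : ∀ j, 0 ≤ f j) (h1 : ∑ j, f j = 1) :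
    ∑ j, (padDist f h0 h1 : Dist (k + r)) j ^ 2 = ∑ j, f j ^ 2 := by
  simp [Fin.sum_univ_add, padDist_castAdd, padDist_natAdd]

theorem sum_sq_castAdd_le (x : Dist (k + r)) : ∑ j, x (Fin.castAdd r j) ^ 2 ≤ ∑ j, x j ^ 2 := by
  rw [Fin.sum_univ_add]
  exact le_add_of_nonneg_right (Finset.sum_nonneg fun _ _ => sq_nonneg _)

theorem utilWelfare_const {m : ℕ} (q : ℕ) (s x : Dist m) :
    utilWelfare (fun _ : Fin q => s) x = -(q * disutility s x) := by
  simp [utilWelfare]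

/-- With `k` agents each on the first and second candidate, every mix of the two is optimal and
tie-breaking gives `1 / 2` each. If the second group splits its weight over two candidates, the
uniform mix of three is optimal and wins, so the first candidate gets less. -/
theorem not_independence_utilRule_even [NeZero (3 + r)] [NeZero (k + k)] (hk : 0 < k) :
    ¬ Independence (utilRule (3 + r)) (k + k) := by
  intro hI
  have hk0 : (0 : ℝ) < k := Nat.cast_pos.2 hk
  let p0 : Dist (3 + r) := pureDist (Fin.castAdd r 0)
  let p1 : Dist (3 + r) := pureDist (Fin.castAdd r 1)
  let s : Dist (3 + r) := padDist ![0, 1 / 2, 1 / 2]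
    (by simp [Fin.forall_fin_succ]) (by simp [Fin.sum_univ_three]; norm_num)
  let I : Profile (3 + r) (k + k) := Fin.append (fun _ => p0) fun _ => p1
  let I' : Profile (3 + r) (k + k) := Fin.append (fun _ => p0) fun _ => s
  have h := hI I I' (Fin.castAdd r 0) fun i => by
    refine Fin.addCases (fun i => ?_) (fun i => ?_) i
    · simp only [I, I', Fin.append_left]
    · simp only [I, I', Fin.append_right, p1, s, pureDist_apply, padDist_castAdd]
      simp
  have hx := util_spec I
  have hx' := util_spec I'
  generalize utilRule (3 + r) (k + k) I = x at *
  generalize utilRule (3 + r) (k + k) I' = x' at *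
  have w : ∀ z, utilWelfare I z =
      -(k * (4 - 2 * (z (Fin.castAdd r 0) + z (Fin.castAdd r 1)))) := fun z => by
    simp only [I, utilWelfare_append, utilWelfare_const, p0, p1, disutility_pureDist]
    ring
  have w' : ∀ z, utilWelfare I' z ≤ -(k * (4 - 2 * (z (Fin.castAdd r 0) + z (Fin.castAdd r 1) +
      z (Fin.castAdd r 2)))) := fun z => by
    simp only [I', utilWelfare_append, utilWelfare_const, p0, s, disutility_pureDist,
      disutility_padDist, Fin.sum_univ_three]
    simp only [Matrix.cons_val_zero, Matrix.cons_val_one, Matrix.cons_val]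
    have h0 := neg_le_abs (0 - z (Fin.castAdd r 0))
    have h1 := le_abs_self (1 / 2 - z (Fin.castAdd r 1))
    have h2 := le_abs_self (1 / 2 - z (Fin.castAdd r 2))
    rw [← neg_add, neg_le_neg_iff, ← mul_add]
    refine mul_le_mul_of_nonneg_left ?_ hk0.le
    linarith
  let y : Dist (3 + r) := padDist ![1 / 2, 1 / 2, 0]
    (by simp [Fin.forall_fin_succ]) (by simp [Fin.sum_univ_three]; norm_num)
  let y' : Dist (3 + r) := padDist ![1 / 3, 1 / 3, 1 / 3]
    (by simp [Fin.forall_fin_succ]) (by simp [Fin.sum_univ_three]; norm_num)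
  have wy : utilWelfare I y = -(2 * k) := by
    rw [w]
    simp only [y, padDist_castAdd]
    simp
    ring
  have wy' : utilWelfare I' y' = -(2 * k) := by
    simp only [I', utilWelfare_append, utilWelfare_const, p0, s, disutility_pureDist,
      disutility_padDist, Fin.sum_univ_three, y', padDist_castAdd]
    simp only [Matrix.cons_val_zero, Matrix.cons_val_one, Matrix.cons_val]
    rw [abs_of_neg (by norm_num), abs_of_pos (by norm_num)]
    ring
  have s3 : ∀ z : Dist (3 + r),
      z (Fin.castAdd r 0) + z (Fin.castAdd r 1) + z (Fin.castAdd r 2) ≤ 1 := fun z => by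
    rw [← Fin.sum_univ_three fun j => z (Fin.castAdd r j)]
    exact sum_castAdd_le_one z
  have q := hx.sum_sq_le y fun z => by
    rw [wy, w]
    nlinarith [s3 z, z.nonneg (Fin.castAdd r 2)]
  have q' := hx'.sum_sq_le y' fun z => by
    rw [wy']
    refine (w' z).trans ?_
    nlinarith [s3 z]
  have g := hx.1 y
  have g' := (hx'.1 y').trans (w' x')
  rw [wy, w] at g
  rw [wy'] at g'
  have e : 1 ≤ x (Fin.castAdd r 0) + x (Fin.castAdd r 1) := by
    by_contra! hlt
    nlinarith
  have e' : 1 ≤ x' (Fin.castAdd r 0) + x' (Fin.castAdd r 1) + x' (Fin.castAdd r 2) := by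
    by_contra! hlt
    nlinarith
  have u := (sum_sq_castAdd_le x).trans q
  have u' := (sum_sq_castAdd_le x').trans q'
  rw [sum_sq_padDist, Fin.sum_univ_three, Fin.sum_univ_three] at u u'
  simp only [Matrix.cons_val_zero, Matrix.cons_val_one, Matrix.cons_val] at u u'
  have sx := s3 x
  have x2 := x.nonneg (Fin.castAdd r 2)
  rw [← h] at u' e'
  have hhalf : x (Fin.castAdd r 0) = 1 / 2 := by
    have : x (Fin.castAdd r 1) = 1 - x (Fin.castAdd r 0) := by linarith
    rw [this] at u
    nlinarith [sq_nonneg (x (Fin.castAdd r 0) - 1 / 2), sq_nonneg (x (Fin.castAdd r 2))]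
  rw [hhalf] at u' e'
  -- Keeping `1 / 2` on the first candidate makes the sum of squares at least `1 / 4 + 1 / 8 = 3 /
  -- 8`, above the `1 / 3` of `y'`.
  nlinarith [sq_nonneg (x' (Fin.castAdd r 1) - x' (Fin.castAdd r 2))]

/-- The midpoint of two distributions. -/
def midpointDist {m : ℕ} (x y : Dist m) : Dist m :=
  ⟨fun j => (x j + y j) / 2, fun j => by linarith [x.nonneg j, y.nonneg j], by
    rw [← Finset.sum_div, Finset.sum_add_distrib, x.sum_eq_one, y.sum_eq_one]
    norm_num⟩

theorem midpointDist_apply {m : ℕ} (x y : Dist m) (j : Fin m) :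
    midpointDist x y j = (x j + y j) / 2 := rfl

/-- The majority of `k + 1` agents gives the first candidate weight zero. If one of them defects to
the third candidate, `p0` becomes optimal as well, and tie-breaking must give the first candidate
some weight. -/
theorem not_independence_utilRule_odd [NeZero (3 + r)] [NeZero (k + (k + 1))] (hk : 0 < k) :
    ¬ Independence (utilRule (3 + r)) (k + (k + 1)) := by
  intro hI
  have hk0 : (1 : ℝ) ≤ k := Nat.one_le_cast.2 hk
  let p0 : Dist (3 + r) := pureDist (Fin.castAdd r 0)
  let p1 : Dist (3 + r) := pureDist (Fin.castAdd r 1)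
  let p2 : Dist (3 + r) := pureDist (Fin.castAdd r 2)
  let I : Profile (3 + r) (k + (k + 1)) := Fin.append (fun _ => p0) fun _ => p1
  let I' : Profile (3 + r) (k + (k + 1)) :=
    Fin.append (fun _ => p0) (Fin.append (fun _ => p1) fun _ => p2)
  have h := hI I I' (Fin.castAdd r 0) fun i => by
    refine Fin.addCases (fun i => ?_) (fun i => ?_) i
    · simp only [I, I', Fin.append_left]
    · refine Fin.addCases (fun i => ?_) (fun i => ?_) i
      · simp only [I, I', Fin.append_right, Fin.append_left]
      · simp only [I, I', Fin.append_right, p1, p2, pureDist_apply]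
        simp
  have hx := util_spec I
  have hx' := util_spec I'
  generalize utilRule (3 + r) (k + (k + 1)) I = x at *
  generalize utilRule (3 + r) (k + (k + 1)) I' = x' at *
  have w : ∀ z, utilWelfare I z = -(k * (2 * (1 - z (Fin.castAdd r 0))) +
      (k + 1) * (2 * (1 - z (Fin.castAdd r 1)))) := fun z => by
    simp only [I, utilWelfare_append, utilWelfare_const, p0, p1, disutility_pureDist]
    push_cast
    ring
  have w' : ∀ z, utilWelfare I' z = -(k * (2 * (1 - z (Fin.castAdd r 0))) +
      k * (2 * (1 - z (Fin.castAdd r 1))) + 2 * (1 - z (Fin.castAdd r 2))) := fun z => by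
    simp only [I', utilWelfare_append, utilWelfare_const, p0, p1, p2, disutility_pureDist]
    push_cast
    ring
  have s3 : ∀ z : Dist (3 + r),
      z (Fin.castAdd r 0) + z (Fin.castAdd r 1) + z (Fin.castAdd r 2) ≤ 1 := fun z => by
    rw [← Fin.sum_univ_three fun j => z (Fin.castAdd r j)]
    exact sum_castAdd_le_one z
  have hx0 : x (Fin.castAdd r 0) = 0 := by
    have g := hx.1 p1
    rw [w, w] at g
    simp only [p1, pureDist_apply] at g
    simp at g
    nlinarith [s3 x, x.nonneg (Fin.castAdd r 0), x.nonneg (Fin.castAdd r 2)]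
  rw [hx0] at h
  have g' := hx'.1 p0
  have wp0 : utilWelfare I' p0 = -(2 * k + 2) := by
    rw [w']
    simp only [p0, pureDist_apply]
    simp
    ring
  have hsum : 1 ≤ x' (Fin.castAdd r 1) + x' (Fin.castAdd r 2) := by
    rw [wp0, w', ← h] at g'
    nlinarith [x'.nonneg (Fin.castAdd r 2)]
  -- Welfare is affine here, so the midpoint with `p0` is optimal too. Comparing squares gives `∑ j,
  -- x' j ^ 2 ≤ 1 / 3`, whereas weight one on two candidates forces at least `1 / 2`. This treats `k
  -- = 1`, where all three candidates tie, together with `k > 1`.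
  have q := hx'.sum_sq_le (midpointDist x' p0) fun z => by
    have hm : utilWelfare I' (midpointDist x' p0) =
        (utilWelfare I' x' + utilWelfare I' p0) / 2 := by
      simp only [w', midpointDist_apply]
      ring
    have hz : utilWelfare I' z ≤ -(2 * k + 2) := by
      rw [w']
      nlinarith [s3 z, z.nonneg (Fin.castAdd r 2)]
    rw [hm]
    linarith
  have hsq : ∑ j, midpointDist x' p0 j ^ 2 = (∑ j, x' j ^ 2 + 1) / 4 := by
    have e : ∀ j, midpointDist x' p0 j ^ 2 =
        (x' j ^ 2 + if j = Fin.castAdd r 0 then 1 else 0) / 4 := fun j => by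
      rw [midpointDist_apply]
      simp only [p0, pureDist_apply]
      split_ifs with hj
      · rw [hj, ← h]; norm_num
      · ring
    simp only [e, ← Finset.sum_div, Finset.sum_add_distrib, Finset.sum_ite_eq', Finset.mem_univ,
      if_true]
  have u := sum_sq_castAdd_le x'
  rw [Fin.sum_univ_three, ← h] at u
  nlinarith [sq_nonneg (x' (Fin.castAdd r 1) - x' (Fin.castAdd r 2))]

theorem not_independence_utilRule [NeZero (3 + r)] [NeZero n] (hn : 2 ≤ n) :
    ¬ Independence (utilRule (3 + r)) n := by
  rcases Nat.even_or_odd' n with ⟨k, rfl | rfl⟩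
  · obtain ⟨q, hq⟩ : ∃ q, q = 2 * k := ⟨_, rfl⟩
    have e : q = k + k := by omega
    revert ‹NeZero (2 * k)›
    rw [← hq, e]
    intro _
    exact not_independence_utilRule_even (by omega)
  · obtain ⟨q, hq⟩ : ∃ q, q = 2 * k + 1 := ⟨_, rfl⟩
    have e : q = k + (k + 1) := by omega
    revert ‹NeZero (2 * k + 1)›
    rw [← hq, e]
    intro _
    exact not_independence_utilRule_odd (by omega)

/-! #### The independent markets rule -/

theorem imScore_of_two_valued {m : ℕ} (I : Profile m n) {t : ℝ} (ht : 0 ≤ t) (j : Fin m)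
    (s : Finset (Fin n)) {b : ℝ} (hb0 : 0 ≤ b) (hb1 : b ≤ 1)
    (h : ∀ i, I i j = if i ∈ s then b else 0) : imScore I t j = min (s.card * t) b := by
  refine eq_of_forall_ge_iff fun a => ?_
  rcases lt_or_ge a 0 with ha | ha
  · have h1 := imScore_nonneg I ht j
    have h2 : 0 ≤ min (s.card * t) b := le_min (by positivity) hb0
    exact ⟨fun h => by linarith, fun h => by linarith⟩
  rw [imScore_le_iff I ht, phantom]
  rcases le_or_gt b a with hba | hba
  · have hc : (Finset.univ.filter fun i => a < I i j) = ∅ :=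
      Finset.filter_eq_empty_iff.2 fun i _ => by
        rw [h, not_lt]
        split_ifs <;> assumption
    rw [hc]
    simp [ha, hba]
  · have hc : (Finset.univ.filter fun i => a < I i j) = s := by
      ext i
      simp only [Finset.mem_filter, Finset.mem_univ, true_and, h]
      split_ifs with hi
      · simp [hi, hba]
      · simp [hi, ha]
    rw [hc, min_le_iff, min_le_iff, or_iff_left (not_le.2 (hba.trans_le hb1)),
      or_iff_left (not_le.2 hba)]

/-- The first candidate receives exactly the stopping time, so independence makes the two times
equal. But splitting the support of the other agents over two candidates replaces `min ((n - 1) * t)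
1` by `2 * min ((n - 1) * t) (1 / 2)` in the total, which is incompatible with the same positive
`t`. -/
theorem not_independence_imRule [NeZero n] (hn : 2 ≤ n) : ¬ Independence (imRule (3 + r)) n := by
  intro hI
  let s : Dist (3 + r) := padDist ![0, 1 / 2, 1 / 2]
    (by simp [Fin.forall_fin_succ]) (by simp [Fin.sum_univ_three]; norm_num)
  let I : Profile (3 + r) n := fun i =>
    if i = 0 then pureDist (Fin.castAdd r 0) else pureDist (Fin.castAdd r 1)
  let I' : Profile (3 + r) n := fun i => if i = 0 then pureDist (Fin.castAdd r 0) else s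
  have h := hI I I' (Fin.castAdd r 0) fun i => by
    simp only [I, I', s]
    split_ifs
    · rfl
    · rw [padDist_castAdd]
      simp [pureDist_apply]
  have t0 := imTime_nonneg I
  have t0' := imTime_nonneg I'
  have t1 : imTime I ≤ 1 := (isLeast_imTime I).1.1.2
  have t1' : imTime I' ≤ 1 := (isLeast_imTime I').1.1.2
  have hT := imTime_pos I
  have hs : ∑ j, imScore I (imTime I) j = 1 := (isLeast_imTime I).1.2
  have hs' : ∑ j, imScore I' (imTime I') j = 1 := (isLeast_imTime I').1.2
  rw [imRule_apply, imRule_apply] at h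
  generalize imTime I = t at *
  generalize imTime I' = t' at *
  have hcard : ((({0}ᶜ : Finset (Fin n)).card : ℕ) : ℝ) = n - 1 := by
    rw [Finset.card_compl, Finset.card_singleton, Fintype.card_fin, Nat.cast_sub (by omega)]
    norm_num
  have hn' : (2 : ℝ) ≤ n := by exact_mod_cast hn
  have a0 : imScore I t (Fin.castAdd r 0) = t := by
    rw [imScore_of_two_valued I t0 _ {0} zero_le_one le_rfl fun i => ?_]
    · simp [t1]
    · simp only [I]
      by_cases hi : i = 0 <;> simp [hi, pureDist_apply]
  have a0' : imScore I' t' (Fin.castAdd r 0) = t' := by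
    rw [imScore_of_two_valued I' t0' _ {0} zero_le_one le_rfl fun i => ?_]
    · simp [t1']
    · simp only [I', s]
      by_cases hi : i = 0
      · simp [hi, pureDist_apply]
      · simp only [hi, if_false, padDist_castAdd]
        simp [hi]
  have a1 : imScore I t (Fin.castAdd r 1) = min ((n - 1) * t) 1 := by
    rw [imScore_of_two_valued I t0 _ {0}ᶜ zero_le_one le_rfl fun i => ?_, hcard]
    simp only [I]
    by_cases hi : i = 0 <;> simp [hi, pureDist_apply]
  have a1' : ∀ j : Fin 3, j ≠ 0 →
      imScore I' t' (Fin.castAdd r j) = min ((n - 1) * t') (1 / 2) := fun j hj => by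
    rw [imScore_of_two_valued I' t0' _ {0}ᶜ (b := 1 / 2) (by norm_num) (by norm_num) fun i => ?_,
      hcard]
    simp only [I', s]
    by_cases hi : i = 0
    · simp [hi, pureDist_apply, hj]
    · simp only [hi, if_false, padDist_castAdd]
      fin_cases j <;> simp [hi] at hj ⊢
  have z : ∀ j : Fin (3 + r), j ≠ Fin.castAdd r 0 → j ≠ Fin.castAdd r 1 → imScore I t j = 0 :=
    fun j h0 h1 => by
      rw [imScore_of_two_valued I t0 j ∅ zero_le_one le_rfl fun i => ?_]
      · simp
      · simp only [I]
        by_cases hi : i = 0 <;> simp [hi, pureDist_apply, h0, h1]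
  have z' : ∀ j : Fin r, imScore I' t' (Fin.natAdd 3 j) = 0 := fun j => by
    have hj : Fin.natAdd 3 j ≠ Fin.castAdd r 0 := by simp [Fin.ext_iff]
    rw [imScore_of_two_valued I' t0' _ ∅ zero_le_one le_rfl fun i => ?_]
    · simp
    · simp only [I', s]
      by_cases hi : i = 0
      · simp [hi, pureDist_apply, hj]
      · simp only [hi, if_false, padDist_natAdd]
        simp
  rw [Fintype.sum_eq_add (Fin.castAdd r 0) (Fin.castAdd r 1) (by simp [Fin.ext_iff])
    fun j hj => z j hj.1 hj.2, a0, a1] at hs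
  rw [Fin.sum_univ_add, Fin.sum_univ_three, a0', a1' 1 (by decide), a1' 2 (by decide),
    Finset.sum_eq_zero fun j _ => z' j] at hs'
  rw [a0, a0'] at h
  subst h
  have hu : 0 < (n - 1) * t := mul_pos (by linarith) hT
  rcases min_cases ((n - 1) * t) 1 with ⟨e, -⟩ | ⟨e, -⟩ <;>
    rcases min_cases ((n - 1) * t) (1 / 2) with ⟨e', -⟩ | ⟨e', -⟩ <;> linarith

end Portioning

end

/-! ### Assembly of the three axioms -/

theorem mainTheorem4 (m : ℕ) [NeZero m] (hm : 2 ≤ m) :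
    -- independence
    ((∀ (n : ℕ) [NeZero n], Independence (avgRule m) n) ∧
      (∀ (n : ℕ) [NeZero n],
        (m = 2 ∨ n = 2 → Independence (medRule m) n) ∧
        (3 ≤ m → 3 ≤ n → ¬ Independence (medRule m) n)) ∧
      (∀ F : AggregationRule m, IsEgalRule F → ∀ (n : ℕ) [NeZero n],
        (m = 2 ∨ (n = 2 ∧ AgreesWithAvgOnPairs F) → Independence F n) ∧
        (3 ≤ m → 3 ≤ n → ¬ Independence F n)) ∧
      (∀ F ∈ ({maxRule m, minRule m, geoRule m, utilRule m, imRule m} : Set (AggregationRule m)),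
        ∀ (n : ℕ) [NeZero n],
          (m = 2 → Independence F n) ∧ (3 ≤ m → 2 ≤ n → ¬ Independence F n))) ∧
    -- score-monotonicity
    ((∀ F ∈ ({avgRule m, maxRule m, minRule m, medRule m, geoRule m, utilRule m, imRule m} : Set (AggregationRule m)),
        ∀ (n : ℕ) [NeZero n], ScoreMonotone F n) ∧
      (∀ F : AggregationRule m, IsEgalRule F → ∀ (n : ℕ) [NeZero n],
        (m = 2 ∨ (n = 2 ∧ AgreesWithAvgOnPairs F) → ScoreMonotone F n) ∧
        (4 ≤ m → 4 ≤ n → ¬ ScoreMonotone F n))) ∧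
    -- reinforcement
    ((∀ F ∈ ({avgRule m, minRule m, maxRule m, geoRule m, utilRule m, imRule m} : Set (AggregationRule m)),
        Reinforcement F) ∧
      (∀ F : AggregationRule m, IsEgalRule F →
        (ConsistentTieBreaking F Set.univ → Reinforcement F) ∧
        (ConsistentTieBreaking F {n | n ≠ 2} →
          ∀ (n n' : ℕ) [NeZero n] [NeZero n'],
            ¬ (n = 2 ∧ n' = 2) → ReinforcementFor F n n')) ∧
      (m = 2 → Reinforcement (medRule m)) ∧
      (3 ≤ m → ∃ (n n' : ℕ) (_ : NeZero n) (_ : NeZero n'),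
        2 ≤ n ∧ 2 ≤ n' ∧ ¬ ReinforcementFor (medRule m) n n')) := by
  refine ⟨⟨fun n _ => independence_avgRule m n, fun n _ => ⟨?_, fun h3 hn => ?_⟩,
    fun F hF n _ => ⟨?_, fun h3 hn => ?_⟩, fun F hF n _ => ⟨?_, fun h3 hn => ?_⟩⟩,
    ⟨fun F hF n _ => ?_, fun F hF n _ => ⟨?_, fun h4 hn => ?_⟩⟩,
    fun F hF => ?_, fun F hF => ⟨fun hc n n' _ _ => ?_, fun hc n n' _ _ hn => ?_⟩, ?_, fun h3 => ?_⟩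
  · rintro (rfl | rfl)
    · exact independence_of_two _ n
    · exact independence_of_agreesWithAvgOnPairs medRule_pair
  · obtain ⟨r, rfl⟩ := Nat.exists_eq_add_of_le h3
    exact not_independence_medRule hn
  · rintro (rfl | ⟨rfl, h⟩)
    · exact independence_of_two F n
    · exact independence_of_agreesWithAvgOnPairs h
  · obtain ⟨r, rfl⟩ := Nat.exists_eq_add_of_le h3
    exact not_independence_egal hF hn
  · rintro rfl
    exact independence_of_two F n
  · obtain ⟨r, rfl⟩ := Nat.exists_eq_add_of_le h3
    rcases hF with rfl | rfl | rfl | rfl | rfl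
    · exact not_independence_maxRule hn
    · exact not_independence_minRule hn
    · exact not_independence_geoRule hn
    · exact not_independence_utilRule hn
    · exact not_independence_imRule hn
  · rcases hF with rfl | rfl | rfl | rfl | rfl | rfl | rfl
    · exact scoreMonotone_avgRule m n
    · exact scoreMonotone_maxRule m n
    · exact scoreMonotone_minRule m n
    · exact scoreMonotone_medRule m n
    · exact scoreMonotone_geoRule m n
    · exact scoreMonotone_utilRule m n
    · exact scoreMonotone_imRule m n
  · rintro (rfl | ⟨rfl, h⟩)
    · exact scoreMonotone_egal_two hF n
    · exact scoreMonotone_of_agreesWithAvgOnPairs h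
  · obtain ⟨r, rfl⟩ := Nat.exists_eq_add_of_le h4
    exact not_scoreMonotone_egal hF hn
  · rcases hF with rfl | rfl | rfl | rfl | rfl | rfl
    · exact reinforcement_avgRule m
    · exact reinforcement_minRule m
    · exact reinforcement_maxRule m
    · exact reinforcement_geoRule m
    · exact reinforcement_utilRule m
    · exact reinforcement_imRule m
  · exact reinforcementFor_of_isEgalRule hF hc n n' (by simp)
  -- The joint electorate has two agents only if `n = n' = 1`, which the uniqueness case covers.
  -- Otherwise one of `n`, `n'` differs from `2` by hypothesis.
  · refine reinforcementFor_of_isEgalRule hF hc n n' ?_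
    have := NeZero.pos n
    have := NeZero.pos n'
    simp only [Set.mem_ofPred_eq]
    omega
  · rintro rfl
    exact reinforcement_medRule_two
  · obtain ⟨r, rfl⟩ := Nat.exists_eq_add_of_le h3
    exact ⟨3, 2, inferInstance, inferInstance, by norm_num, le_rfl, not_reinforcementFor_medRule⟩
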